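/- For $k\ge 1$, say that a set $S\subseteq\mathbb{Z}^k$ has natural density $\delta$ if for every $z\in\mathbb{Z}^k$ $$\lim_{B\to\infty}\frac{\left|S\cap\prod_{i=1}^k[z_i-B,\,z_i+B[\right|}{(2B)^k}=\delta ,$$ where $B$ runs through the positive real numbers; $n\times n$ integer matrices are viewed as points of $\mathbb{Z}^{n^2}$. An integer matrix $H$ is in Hermite normal form if it is upper triangular, its nonzero rows are its first $r$ rows for some $r\geq 0$, the first nonzero entry $h_{ij_i}$ of each row $i\le r$ is positive with $j_1<\dots<j_r$, and $0\le h_{kj_i}<h_{ij_i}$ for all $1\le k<i\le r$. The Hermite normal form $\mathrm{HNF}(A)$ of an integer matrix $A$ with $n$ rows is the unique matrix $H$ in Hermite normal form such that $A=UH$ for some $U\in\mathrm{GL}_n(\mathbb{Z})$. Let $n\ge 2$ and let $d_1,\dots,d_{n-1}$ be positive integers. Then the set of $n\times n$ integer matrices $A$ such that $\mathrm{HNF}(A)$ has diagonal $$\left(d_1,d_2,\dots,d_{n-1},\frac{|\det A|}{\prod_{i=1}^{n-1}d_i}\right)$$ has a natural density, and it is equal to $$\left(\zeta(n)\,\zeta(n-1)\cdots\zeta(2)\cdot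 d_1^{\,n}\,d_2^{\,n-1}\cdots d_{n-1}^{\,2}\right)^{-1},$$ where $\zeta$ is the Riemann zeta function. -/

import Mathlib

open Filter Topology

namespace HermiteDensity

/-- The integer points of the cube `∏ i, [z i - B, z i + B[`. -/
def cube {ι : Type*} (z : ι → ℤ) (B : ℝ) : Set (ι → ℤ) :=
  {x | ∀ i, (z i : ℝ) - B ≤ (x i : ℝ) ∧ (x i : ℝ) < (z i : ℝ) + B}

/-- `S ⊆ ℤ^ι` has natural density `δ`: for every integer centre `z`, the proportion of points of
`S` in the cube of centre `z` and side `2 * B` tends to `δ` (the same for all `z`) as the real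
number `B` tends to infinity. -/
def HasNaturalDensity {ι : Type*} [Fintype ι] (S : Set (ι → ℤ)) (δ : ℝ) : Prop :=
  ∀ z : ι → ℤ,
    Tendsto (fun B : ℝ => ((S ∩ cube z B).ncard : ℝ) / (2 * B) ^ Fintype.card ι) atTop (𝓝 δ)

/-- Natural density of a set of `n × m` integer matrices, seen as a subset of `ℤ^(n * m)`. -/
def HasMatrixDensity {n m : ℕ} (S : Set (Matrix (Fin n) (Fin m) ℤ)) (δ : ℝ) : Prop :=
  HasNaturalDensity
    {x : Fin n × Fin m → ℤ | (Matrix.of fun i j => x (i, j)) ∈ S} δ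

/-- `H` is in Hermite normal form: it is upper triangular, its nonzero rows are the first `r`
ones, the first nonzero entry of row `i` is positive and in column `j i`, the `j i` are strictly
increasing, and the entries above a pivot are nonnegative and less than that pivot. -/
def IsHNF {n m : ℕ} (H : Matrix (Fin n) (Fin m) ℤ) : Prop :=
  (∀ (i : Fin n) (l : Fin m), (l : ℕ) < (i : ℕ) → H i l = 0) ∧
  ∃ (r : ℕ) (hr : r ≤ n) (j : Fin r → Fin m),
    StrictMono j ∧
    (∀ i : Fin n, r ≤ (i : ℕ) → ∀ l, H i l = 0) ∧
    (∀ i : Fin r, (∀ l, l < j i → H (Fin.castLE hr i) l = 0) ∧ 0 < H (Fin.castLE hr i) (j i)) ∧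
    (∀ k i : Fin r, k < i →
      0 ≤ H (Fin.castLE hr k) (j i) ∧ H (Fin.castLE hr k) (j i) < H (Fin.castLE hr i) (j i))

/-- `H` is the Hermite normal form of `A`: `H` is in Hermite normal form and `A = U * H` for some
unimodular `U`. (Every integer matrix has exactly one Hermite normal form.) -/
def IsHNFOf {n m : ℕ} (A H : Matrix (Fin n) (Fin m) ℤ) : Prop :=
  IsHNF H ∧ ∃ U : Matrix.GeneralLinearGroup (Fin n) ℤ, A = (U : Matrix (Fin n) (Fin n) ℤ) * H

/-- The real number `ζ(k)`. -/
noncomputable def realZeta (k : ℕ) : ℝ := (riemannZeta (k : ℂ)).re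

/-- For `k ≥ 2`, `realZeta k` is the usual series (so no information is lost by taking the real
part). -/
theorem realZeta_eq_tsum {k : ℕ} (hk : 2 ≤ k) : realZeta k = ∑' m : ℕ, 1 / (m : ℝ) ^ k := by
  have h : riemannZeta (k : ℂ) = ((∑' m : ℕ, 1 / (m : ℝ) ^ k : ℝ) : ℂ) := by
    rw [zeta_nat_eq_tsum_of_gt_one (by omega)]
    push_cast
    rfl
  rw [realZeta, h, Complex.ofReal_re]

end HermiteDensity

/-! Put `m = n - 1`. The first `m` diagonal entries of the Hermite form of `A` are the `d i` exactly
when the first `m` columns of `A` equal (first `m` columns of a unimodular matrix) times `H`, for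
some `m × m` Hermite block `H` with diagonal `d`; comparing determinants then forces the last
diagonal entry (`exists_isHNFOf_iff`). Different blocks give disjoint sets (`hnfBlock_unique`), and
there are `∏ d j ^ j` blocks, with `j` counted from `0`.

For a fixed block, the set is the image of the primitive matrices under right multiplication by
`diag(H, 1)`, an injective endomorphism of `ℤ^(n²)` of index `(∏ d j) ^ n`, so its density is that
of the primitive matrices divided by this index. A matrix is primitive when no prime divides all `m
× m` minors of its first `m` columns (`isPrim_iff`). Modulo `p` this has probability `∏_{k=2}^{n} (1
- p^(-k))`; the Chinese remainder theorem handles finitely many primes, and the Euler product gives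
`1 / (ζ(2) ⋯ ζ(n))` in the limit.

Passing to all primes requires that matrices degenerate modulo some prime `p > M` have upper density
`O(1/M)` (`exists_density_degenerateAbove_le`). Degeneracy modulo `p` has codimension two: some
minor `D` prime to `p` is the common slope of two affine forms in two different entries, both
divisible by `p`. The tail is therefore governed by `∑_{p > M} p⁻²`, with a separate count for
primes larger than the box (`card_pairs_le`). -/

namespace HermiteDensity

/-! ### Natural density: residue classes, finite quotients, images and approximation. -/

section Density

variable {ι : Type*} [Fintype ι]

/-- The cube as a finite set. -/
noncomputable def cubeFinset [DecidableEq ι] (z : ι → ℤ) (B : ℝ) : Finset (ι → ℤ) :=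
  Fintype.piFinset fun i => Finset.Ico ⌈(z i : ℝ) - B⌉ ⌈(z i : ℝ) + B⌉

theorem mem_cubeFinset [DecidableEq ι] {z : ι → ℤ} {B : ℝ} {x : ι → ℤ} :
    x ∈ cubeFinset z B ↔ x ∈ cube z B := by
  simp only [cubeFinset, cube, Fintype.mem_piFinset, Finset.mem_Ico, Int.ceil_le, Int.lt_ceil,
    Set.mem_ofPred_eq]

theorem coe_cubeFinset [DecidableEq ι] (z : ι → ℤ) (B : ℝ) :
    (cubeFinset z B : Set (ι → ℤ)) = cube z B :=
  Set.ext fun _ => mem_cubeFinset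

theorem cube_finite (z : ι → ℤ) (B : ℝ) : (cube z B).Finite := by
  classical
  rw [← coe_cubeFinset]
  exact Finset.finite_toSet _

theorem inter_cube_finite (S : Set (ι → ℤ)) (z : ι → ℤ) (B : ℝ) : (S ∩ cube z B).Finite :=
  (cube_finite z B).subset Set.inter_subset_right

theorem HasNaturalDensity.unique {S : Set (ι → ℤ)} {δ ε : ℝ} (h : HasNaturalDensity S δ)
    (h' : HasNaturalDensity S ε) : δ = ε :=
  tendsto_nhds_unique (h 0) (h' 0)

theorem hasNaturalDensity_empty : HasNaturalDensity (∅ : Set (ι → ℤ)) 0 := by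
  intro z
  simp

theorem HasNaturalDensity.union {S T : Set (ι → ℤ)} {δ ε : ℝ} (hS : HasNaturalDensity S δ)
    (hT : HasNaturalDensity T ε) (hd : Disjoint S T) : HasNaturalDensity (S ∪ T) (δ + ε) := by
  intro z
  refine ((hS z).add (hT z)).congr fun B => ?_
  rw [Set.union_inter_distrib_right, Set.ncard_union_eq _ (inter_cube_finite _ _ _)
    (inter_cube_finite _ _ _), Nat.cast_add, add_div]
  exact hd.mono Set.inter_subset_left Set.inter_subset_left

theorem HasNaturalDensity.biUnion {κ : Type*} (s : Finset κ) {S : κ → Set (ι → ℤ)} {δ : κ → ℝ}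
    (h : ∀ k ∈ s, HasNaturalDensity (S k) (δ k)) (hd : (s : Set κ).PairwiseDisjoint S) :
    HasNaturalDensity (⋃ k ∈ s, S k) (∑ k ∈ s, δ k) := by
  classical
  induction s using Finset.induction_on with
  | empty => simpa using hasNaturalDensity_empty
  | insert a s ha ih =>
    rw [Finset.set_biUnion_insert, Finset.sum_insert ha]
    refine (h a (by simp)).union (ih (fun k hk => h k (by simp [hk]))
      (hd.subset (by simp))) ?_
    rw [Set.disjoint_iUnion₂_right]
    intro k hk
    exact hd (by simp) (by simp [hk]) (by rintro rfl; exact ha hk)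

theorem HasNaturalDensity.translate {S : Set (ι → ℤ)} {δ : ℝ} (h : HasNaturalDensity S δ)
    (t : ι → ℤ) : HasNaturalDensity ((fun x => t + x) '' S) δ := by
  intro z
  refine (h (z - t)).congr fun B => ?_
  congr 2
  have : ((fun x => t + x) '' S) ∩ cube z B = (fun x => t + x) '' (S ∩ cube (z - t) B) := by
    rw [Set.image_inter (add_right_injective t)]
    congr 1
    ext x
    constructor
    · intro hx
      refine ⟨x - t, fun i => ?_, by simp⟩
      have := hx i
      simp only [Pi.sub_apply, Int.cast_sub]
      constructor <;> linarith
    · rintro ⟨y, hy, rfl⟩ i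
      have := hy i
      simp only [Pi.sub_apply, Int.cast_sub] at this
      simp only [Pi.add_apply, Int.cast_add]
      constructor <;> linarith
  rw [this, Set.ncard_image_of_injective _ (add_right_injective t)]

/-- The count is a difference of two ceilings. Rounding the endpoints costs at most `1 / N`, the
ceilings themselves at most `1`, so the error is bounded independently of `B`. -/
theorem tendsto_card_modEq_div (N : ℕ) (hN : 0 < N) (z v : ℤ) :
    Tendsto (fun B : ℝ => (((Finset.Ico ⌈(z : ℝ) - B⌉ ⌈(z : ℝ) + B⌉).filter
      (fun x => x ≡ v [ZMOD N])).card : ℝ) / (2 * B)) atTop (𝓝 (1 / N)) := by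
  have hN' : (0 : ℝ) < N := by exact_mod_cast hN
  have key : ∀ B : ℝ, 0 < B →
      |(((Finset.Ico ⌈(z : ℝ) - B⌉ ⌈(z : ℝ) + B⌉).filter
        (fun x => x ≡ v [ZMOD N])).card : ℝ) - 2 * B / N| ≤ 1 / N + 1 := by
    intro B hB
    have hle : ⌈(z : ℝ) - B⌉ ≤ ⌈(z : ℝ) + B⌉ := Int.ceil_le_ceil (by linarith)
    have hc : (((Finset.Ico ⌈(z : ℝ) - B⌉ ⌈(z : ℝ) + B⌉).filter
        (fun x => x ≡ v [ZMOD N])).card : ℤ) =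
        ⌈(((⌈(z : ℝ) + B⌉ - v : ℤ) : ℝ) / (N : ℝ))⌉ -
        ⌈(((⌈(z : ℝ) - B⌉ - v : ℤ) : ℝ) / (N : ℝ))⌉ := by
      rw [Int.Ico_filter_modEq_card _ _ (by exact_mod_cast hN)]
      have e : ∀ a : ℤ, ⌈((a : ℚ) - v) / ((N : ℤ) : ℚ)⌉ = ⌈(((a - v : ℤ) : ℝ) / (N : ℝ))⌉ := by
        intro a
        rw [← Rat.ceil_cast (α := ℝ)]
        push_cast
        rfl
      rw [e, e, max_eq_left]
      rw [sub_nonneg]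
      apply Int.ceil_le_ceil
      gcongr
    have hc' : (((Finset.Ico ⌈(z : ℝ) - B⌉ ⌈(z : ℝ) + B⌉).filter
        (fun x => x ≡ v [ZMOD N])).card : ℝ) =
        (⌈(((⌈(z : ℝ) + B⌉ - v : ℤ) : ℝ) / (N : ℝ))⌉ : ℝ) -
        ⌈(((⌈(z : ℝ) - B⌉ - v : ℤ) : ℝ) / (N : ℝ))⌉ := by exact_mod_cast hc
    rw [hc']
    have h1 := Int.le_ceil (((⌈(z : ℝ) + B⌉ - v : ℤ) : ℝ) / (N : ℝ))
    have h2 := Int.ceil_lt_add_one (((⌈(z : ℝ) + B⌉ - v : ℤ) : ℝ) / (N : ℝ))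
    have h3 := Int.le_ceil (((⌈(z : ℝ) - B⌉ - v : ℤ) : ℝ) / (N : ℝ))
    have h4 := Int.ceil_lt_add_one (((⌈(z : ℝ) - B⌉ - v : ℤ) : ℝ) / (N : ℝ))
    have h5 := Int.le_ceil ((z : ℝ) + B)
    have h6 := Int.ceil_lt_add_one ((z : ℝ) + B)
    have h7 := Int.le_ceil ((z : ℝ) - B)
    have h8 := Int.ceil_lt_add_one ((z : ℝ) - B)
    have h9 : ((⌈(z : ℝ) + B⌉ - v : ℤ) : ℝ) / (N : ℝ) - ((⌈(z : ℝ) - B⌉ - v : ℤ) : ℝ) / (N : ℝ)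
        = ((⌈(z : ℝ) + B⌉ : ℝ) - ⌈(z : ℝ) - B⌉) / N := by push_cast; ring
    have h10 : ((⌈(z : ℝ) + B⌉ : ℝ) - ⌈(z : ℝ) - B⌉) / N ≤ (2 * B + 1) / N := by
      gcongr; linarith
    have h11 : (2 * B - 1) / N ≤ ((⌈(z : ℝ) + B⌉ : ℝ) - ⌈(z : ℝ) - B⌉) / N :=
      div_le_div_of_nonneg_right (by linarith) hN'.le
    rw [add_div] at h10
    rw [sub_div] at h11
    rw [abs_le]
    constructor <;> linarith
  rw [tendsto_iff_norm_sub_tendsto_zero]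
  refine squeeze_zero' (Eventually.of_forall fun B => norm_nonneg _)
    (g := fun B : ℝ => (1 / N + 1) / (2 * B)) ?_ ?_
  · filter_upwards [eventually_gt_atTop 0] with B hB
    have : (((Finset.Ico ⌈(z : ℝ) - B⌉ ⌈(z : ℝ) + B⌉).filter
        (fun x => x ≡ v [ZMOD N])).card : ℝ) / (2 * B) - 1 / N =
      ((((Finset.Ico ⌈(z : ℝ) - B⌉ ⌈(z : ℝ) + B⌉).filter
        (fun x => x ≡ v [ZMOD N])).card : ℝ) - 2 * B / N) / (2 * B) := by
      field_simp
    rw [this, norm_div, Real.norm_eq_abs, Real.norm_of_nonneg (by positivity : 0 ≤ 2 * B)]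
    gcongr
    exact key B hB
  · exact tendsto_const_nhds.div_atTop (tendsto_id.const_mul_atTop two_pos)

theorem hasNaturalDensity_modEq (N : ℕ) (hN : 0 < N) (v : ι → ℤ) :
    HasNaturalDensity {x : ι → ℤ | ∀ i, x i ≡ v i [ZMOD N]} ((1 / N) ^ Fintype.card ι) := by
  classical
  intro z
  have h := tendsto_finsetProd (Finset.univ : Finset ι)
    (fun i _ => tendsto_card_modEq_div N hN (z i) (v i))
  rw [Finset.prod_const, Finset.card_univ] at h
  refine h.congr fun B => ?_
  rw [Finset.prod_div_distrib, Finset.prod_const, Finset.card_univ, ← Nat.cast_prod,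
    ← Fintype.card_piFinset, ← Set.ncard_coe_finset]
  congr 3
  ext x
  simp only [Finset.mem_coe, Fintype.mem_piFinset, Finset.mem_filter, Set.mem_inter_iff,
    Set.mem_ofPred_eq, ← coe_cubeFinset, cubeFinset]
  rw [← forall_and]
  exact forall_congr' fun i => and_comm

theorem hasNaturalDensity_univ : HasNaturalDensity (Set.univ : Set (ι → ℤ)) 1 := by
  have h := hasNaturalDensity_modEq 1 one_pos (0 : ι → ℤ)
  simpa [Int.modEq_one] using h

/-- A set which is a union of residue classes has a density. -/
theorem exists_density_of_periodic {S : Set (ι → ℤ)} (N : ℕ) (hN : 0 < N)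
    (hS : ∀ x y : ι → ℤ, (∀ i, x i ≡ y i [ZMOD N]) → x ∈ S → y ∈ S) :
    ∃ δ, HasNaturalDensity S δ := by
  classical
  let R : Finset (ι → ℤ) := (Fintype.piFinset fun _ => Finset.Ico (0 : ℤ) N).filter (· ∈ S)
  have hR : S = ⋃ v ∈ R, {x : ι → ℤ | ∀ i, x i ≡ v i [ZMOD N]} := by
    ext x
    simp only [R, Set.mem_iUnion, Finset.mem_filter, Fintype.mem_piFinset, Set.mem_ofPred_eq,
      exists_prop, Finset.mem_Ico]
    have hN' : (0 : ℤ) < N := by exact_mod_cast hN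
    constructor
    · intro hx
      refine ⟨fun i => x i % N, ⟨fun i => ⟨Int.emod_nonneg _ hN'.ne', Int.emod_lt_of_pos _ hN'⟩,
        hS x _ (fun i => (Int.mod_modEq _ _).symm) hx⟩, fun i => (Int.mod_modEq _ _).symm⟩
    · rintro ⟨v, ⟨_, hv⟩, h⟩
      exact hS v x (fun i => (h i).symm) hv
  rw [hR]
  refine ⟨_, HasNaturalDensity.biUnion R (fun v _ => hasNaturalDensity_modEq N hN v) ?_⟩
  intro v hv w hw hvw
  rw [Function.onFun, Set.disjoint_left]
  intro x hx hx'
  apply hvw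
  funext i
  simp only [R, Finset.coe_filter, Fintype.mem_piFinset, Set.mem_ofPred_eq, Finset.mem_Ico] at hv hw
  have := (hx i).symm.trans (hx' i)
  rw [Int.ModEq, Int.emod_eq_of_lt (hv.1 i).1 (hv.1 i).2, Int.emod_eq_of_lt (hw.1 i).1 (hw.1 i).2]
    at this
  exact this

/-- Such a subgroup is a union of classes modulo `N`. Only existence is needed: the values are found
later by comparing cosets. -/
theorem exists_density_of_nsmul_mem (L : AddSubgroup (ι → ℤ)) (N : ℕ) (hN : 0 < N)
    (hL : ∀ x, N • x ∈ L) : ∃ δ, HasNaturalDensity (L : Set (ι → ℤ)) δ := by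
  refine exists_density_of_periodic N hN fun x y h hx => ?_
  choose c hc using fun i => (h i).dvd
  have : y = x + N • c := by
    funext i
    have := hc i
    rw [Pi.add_apply, Pi.smul_apply, nsmul_eq_mul]
    linarith
  rw [this]
  exact L.add_mem hx (hL c)

/-- Preimages under a surjection onto a finite group have the expected density. -/
theorem hasNaturalDensity_preimage {G : Type*} [AddCommGroup G] [Finite G]
    (ψ : (ι → ℤ) →+ G) (hψ : Function.Surjective ψ) (T : Set G) :
    HasNaturalDensity (ψ ⁻¹' T) (T.ncard / Nat.card G) := by
  classical
  have := Fintype.ofFinite G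
  obtain ⟨δ, hδ⟩ := exists_density_of_nsmul_mem ψ.ker (Nat.card G) Nat.card_pos
    (fun x => by rw [AddMonoidHom.mem_ker, map_nsmul]; exact card_nsmul_eq_zero')
  -- The fibres are translates of the kernel, so they share one density `δ`; summing over `G` to get
  -- density `1` forces `δ = 1 / |G|`.
  have hfib : ∀ g : G, HasNaturalDensity (ψ ⁻¹' {g}) δ := by
    intro g
    obtain ⟨t, rfl⟩ := hψ g
    convert hδ.translate t using 1
    ext x
    simp only [Set.mem_preimage, Set.mem_singleton_iff, Set.mem_image, SetLike.mem_coe,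
      AddMonoidHom.mem_ker]
    constructor
    · intro h
      exact ⟨x - t, by simp [h], by simp⟩
    · rintro ⟨y, hy, rfl⟩
      simp [hy]
  have hT : ∀ T : Finset G, HasNaturalDensity (ψ ⁻¹' T) (T.card * δ) := by
    intro T
    have h := HasNaturalDensity.biUnion T (S := fun g => ψ ⁻¹' {g}) (δ := fun _ => δ)
      (fun g _ => hfib g) (fun g _ g' _ hne => by
        rw [Function.onFun, Set.disjoint_left]
        rintro x rfl h
        exact hne h)
    rw [Finset.sum_const, nsmul_eq_mul] at h
    convert h using 1
    ext x
    simp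
  have h1 := hT Finset.univ
  rw [Finset.coe_univ, Set.preimage_univ, Finset.card_univ] at h1
  have h2 := h1.unique hasNaturalDensity_univ
  have hc : (Nat.card G : ℝ) ≠ 0 := by
    exact_mod_cast Nat.card_pos.ne'
  have h3 : δ = 1 / Nat.card G := by
    rw [Nat.card_eq_fintype_card] at *
    field_simp
    linarith
  have h4 := hT T.toFinset
  rw [h3, Set.coe_toFinset, ← Set.ncard_eq_toFinset_card'] at h4
  simpa [div_eq_mul_inv] using h4

/-- An injective endomorphism of `ℤ^ι` divides densities by the index of its range. -/
theorem hasNaturalDensity_image_preimage {G : Type*} [AddCommGroup G] [Finite G]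
    (ψ : (ι → ℤ) →+ G) (hψ : Function.Surjective ψ) (φ : (ι → ℤ) →+ (ι → ℤ))
    (hφ : Function.Injective φ) (hq : φ.range.index ≠ 0) (T : Set G) :
    HasNaturalDensity (φ '' (ψ ⁻¹' T)) (T.ncard / Nat.card G / φ.range.index) := by
  classical
  have := Fintype.ofFinite G
  obtain ⟨δ, hδ⟩ := exists_density_of_nsmul_mem (ψ.ker.map φ) (Nat.card G * φ.range.index)
    (Nat.mul_pos Nat.card_pos (Nat.pos_of_ne_zero hq))
    (fun x => by
      obtain ⟨y, hy⟩ := φ.range.nsmul_index_mem x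
      rw [mul_nsmul', ← hy, ← map_nsmul]
      refine AddSubgroup.mem_map_of_mem _ ?_
      rw [AddMonoidHom.mem_ker, map_nsmul]
      exact card_nsmul_eq_zero')
  have hfib : ∀ g : G, HasNaturalDensity (φ '' (ψ ⁻¹' {g})) δ := by
    intro g
    obtain ⟨t, rfl⟩ := hψ g
    convert hδ.translate (φ t) using 1
    ext x
    simp only [Set.mem_image, Set.mem_preimage, Set.mem_singleton_iff, SetLike.mem_coe,
      AddSubgroup.mem_map, AddMonoidHom.mem_ker]
    constructor
    · rintro ⟨y, hy, rfl⟩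
      exact ⟨φ (y - t), ⟨y - t, by simp [hy], rfl⟩, by simp⟩
    · rintro ⟨_, ⟨y, hy, rfl⟩, rfl⟩
      exact ⟨t + y, by simp [hy], by simp⟩
  have hT : ∀ T : Finset G, HasNaturalDensity (φ '' (ψ ⁻¹' T)) (T.card * δ) := by
    intro T
    have h := HasNaturalDensity.biUnion T (S := fun g => φ '' (ψ ⁻¹' {g})) (δ := fun _ => δ)
      (fun g _ => hfib g) (fun g _ g' _ hne => by
        rw [Function.onFun, Set.disjoint_image_iff hφ, Set.disjoint_left]
        rintro x rfl h
        exact hne h)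
    rw [Finset.sum_const, nsmul_eq_mul] at h
    convert h using 1
    ext x
    simp
  have h1 := hT Finset.univ
  rw [Finset.coe_univ, Set.preimage_univ, Finset.card_univ] at h1
  have : Finite ((ι → ℤ) ⧸ φ.range) := by
    have : φ.range.FiniteIndex := ⟨hq⟩
    exact AddSubgroup.finite_quotient_of_finiteIndex
  -- The total mass is now the density of the range of `φ`, which is the fibre over `0` of the
  -- quotient map.
  have h2 := hasNaturalDensity_preimage (QuotientAddGroup.mk' φ.range)
    (QuotientAddGroup.mk'_surjective _) {0}
  have h2' : φ '' Set.univ = (QuotientAddGroup.mk' φ.range) ⁻¹' {0} := by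
    ext x
    simp
  rw [← h2'] at h2
  have h2 := HasNaturalDensity.unique h1 h2
  have hc : (Nat.card G : ℝ) ≠ 0 := by
    exact_mod_cast Nat.card_pos.ne'
  have hq' : (φ.range.index : ℝ) ≠ 0 := by exact_mod_cast hq
  have h3 : δ = 1 / Nat.card G / φ.range.index := by
    rw [Set.ncard_singleton, ← AddSubgroup.index_eq_card] at h2
    rw [← Nat.card_eq_fintype_card] at h2
    rw [eq_div_iff hq', eq_div_iff hc]
    field_simp at h2
    push_cast at h2
    linarith
  have h4 := hT T.toFinset
  rw [h3, Set.coe_toFinset, ← Set.ncard_eq_toFinset_card'] at h4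
  convert h4 using 1
  ring

/-- Approximation of a set from outside by sets with a density, up to sets of small upper
density. -/
theorem hasNaturalDensity_of_approx {S : Set (ι → ℤ)} {U T : ℕ → Set (ι → ℤ)} {δ : ℕ → ℝ}
    {δ₀ C : ℝ} (hSU : ∀ M, S ⊆ U M) (hUT : ∀ M, U M ⊆ S ∪ T M)
    (hU : ∀ M, HasNaturalDensity (U M) (δ M)) (hδ : Tendsto δ atTop (𝓝 δ₀))
    (hT : ∀ M : ℕ, 0 < M → ∀ z : ι → ℤ, ∀ᶠ B : ℝ in atTop,
      ((T M ∩ cube z B).ncard : ℝ) / (2 * B) ^ Fintype.card ι ≤ C / M) :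
    HasNaturalDensity S δ₀ := by
  intro z
  rw [Metric.tendsto_atTop']
  intro ε hε
  have hC : Tendsto (fun M : ℕ => C / M) atTop (𝓝 0) :=
    tendsto_const_nhds.div_atTop tendsto_natCast_atTop_atTop
  obtain ⟨M, hM1, hM2, hM0⟩ := ((hδ.eventually (Metric.ball_mem_nhds δ₀ (by positivity :
    0 < ε / 4))).and ((hC.eventually (gt_mem_nhds (by positivity : 0 < ε / 4))).and
      (eventually_gt_atTop 0))).exists
  have h1 := (hU M z).eventually (Metric.ball_mem_nhds (δ M) (by positivity : 0 < ε / 4))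
  obtain ⟨N, hN⟩ := eventually_atTop.1 ((h1.and (hT M hM0 z)).and (eventually_gt_atTop 0))
  refine ⟨N, fun B hB => ?_⟩
  obtain ⟨⟨h2, h3⟩, h4⟩ := hN B hB.le
  have hpos : 0 < (2 * B) ^ Fintype.card ι := by positivity
  have h5 : ((S ∩ cube z B).ncard : ℝ) / (2 * B) ^ Fintype.card ι ≤
      ((U M ∩ cube z B).ncard : ℝ) / (2 * B) ^ Fintype.card ι := by
    gcongr
    · exact inter_cube_finite _ _ _
    · exact hSU M
  have h6 : ((U M ∩ cube z B).ncard : ℝ) / (2 * B) ^ Fintype.card ι ≤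
      ((S ∩ cube z B).ncard : ℝ) / (2 * B) ^ Fintype.card ι +
      ((T M ∩ cube z B).ncard : ℝ) / (2 * B) ^ Fintype.card ι := by
    rw [← add_div]
    gcongr
    have : (U M ∩ cube z B).ncard ≤ ((S ∩ cube z B) ∪ (T M ∩ cube z B)).ncard := by
      apply Set.ncard_le_ncard _ ((inter_cube_finite _ _ _).union (inter_cube_finite _ _ _))
      rw [← Set.union_inter_distrib_right]
      exact Set.inter_subset_inter_left _ (hUT M)
    exact_mod_cast this.trans (Set.ncard_union_le _ _)
  rw [Real.dist_eq, abs_lt] at h2 hM1 ⊢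
  constructor <;> linarith

end Density

/-! ### Counting pairs of affine values with a common large prime factor. -/

section Sieve

/-- The product of the primes in `P` divides `f` and is at least `B ^ P.card`. -/
theorem card_prime_divisors_le {f : ℤ} (hf : f ≠ 0) {B : ℝ} (hB : 1 ≤ B) {K : ℕ}
    (hfB : (|f| : ℝ) < B ^ K) (P : Finset ℕ) (hP : ∀ p ∈ P, p.Prime ∧ B < p ∧ (p : ℤ) ∣ f) :
    P.card ≤ K := by
  have h1 : ∏ p ∈ P, p ∣ f.natAbs :=
    Finset.prod_primes_dvd _ (fun p hp => (hP p hp).1.prime)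
      (fun p hp => Int.natCast_dvd.1 (hP p hp).2.2)
  have h2 := Nat.le_of_dvd (Int.natAbs_pos.2 hf) h1
  have h3 : ((∏ p ∈ P, p : ℕ) : ℝ) ≤ |(f : ℝ)| := by
    have : ((∏ p ∈ P, p : ℕ) : ℝ) ≤ (f.natAbs : ℝ) := by exact_mod_cast h2
    rwa [Nat.cast_natAbs, Int.cast_abs] at this
  have h4 : B ^ P.card ≤ ((∏ p ∈ P, p : ℕ) : ℝ) := by
    rw [← Finset.prod_const, Nat.cast_prod]
    exact Finset.prod_le_prod (fun _ _ => by linarith) (fun p hp => (hP p hp).2.1.le)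
  by_contra! h
  have := pow_le_pow_right₀ hB h.le
  linarith

theorem card_Ico_le {a b : ℤ} {L : ℝ} (hL : 0 ≤ L) (hab : (b : ℝ) - a ≤ L) :
    ((Finset.Ico a b).card : ℝ) ≤ L := by
  rw [Int.card_Ico]
  rcases le_total 0 (b - a) with h | h
  · have : (((b - a).toNat : ℤ) : ℝ) = b - a := by rw [Int.toNat_of_nonneg h]; push_cast; rfl
    rw [← Int.cast_natCast (R := ℝ), this]
    exact hab
  · rw [Int.toNat_of_nonpos h]
    simpa using hL

/-- Since `D` is invertible modulo `p`, the solutions lie in a single residue class. -/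
theorem card_filter_dvd_affine_le {a b D c : ℤ} {p : ℕ} (hp : p.Prime) (hD : ¬ (p : ℤ) ∣ D)
    {L : ℝ} (hL : 0 ≤ L) (hab : (b : ℝ) - a ≤ L) :
    (((Finset.Ico a b).filter (fun x => (p : ℤ) ∣ D * x + c)).card : ℝ) ≤ L / p + 1 := by
  have hp0 : (0 : ℝ) < p := by exact_mod_cast hp.pos
  rcases Finset.eq_empty_or_nonempty ((Finset.Ico a b).filter (fun x => (p : ℤ) ∣ D * x + c))
    with h | ⟨v, hv⟩
  · rw [h]
    simp only [Finset.card_empty, Nat.cast_zero]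
    positivity
  · have hv := (Finset.mem_filter.1 hv)
    have hab' : a ≤ b := ((Finset.mem_Ico.1 hv.1).1.trans_lt (Finset.mem_Ico.1 hv.1).2).le
    have hsub : (Finset.Ico a b).filter (fun x => (p : ℤ) ∣ D * x + c) ⊆
        (Finset.Ico a b).filter (fun x => x ≡ v [ZMOD p]) := by
      intro x hx
      rw [Finset.mem_filter] at hx ⊢
      refine ⟨hx.1, ?_⟩
      have h1 : (p : ℤ) ∣ D * (v - x) := by
        have := dvd_sub hv.2 hx.2
        ring_nf at this ⊢
        exact this
      exact Int.modEq_iff_dvd.2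
        (((Nat.prime_iff_prime_int.1 hp).dvd_or_dvd h1).resolve_left hD)
    have h2 : (((Finset.Ico a b).filter (fun x => x ≡ v [ZMOD p])).card : ℝ) ≤ L / p + 1 := by
      have h3 := Int.Ico_filter_modEq_card a b (r := (p : ℤ)) (by exact_mod_cast hp.pos) v
      have hle : ⌈((a : ℚ) - v) / ((p : ℤ) : ℚ)⌉ ≤ ⌈((b : ℚ) - v) / ((p : ℤ) : ℚ)⌉ := by
        apply Int.ceil_le_ceil
        have : (a : ℚ) ≤ b := by exact_mod_cast hab'
        have hp0 : (0 : ℚ) < ((p : ℤ) : ℚ) := by exact_mod_cast hp.pos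
        gcongr
      rw [max_eq_left (by linarith)] at h3
      have h4 : (((Finset.Ico a b).filter (fun x => x ≡ v [ZMOD p])).card : ℚ) ≤
          ((b : ℚ) - a) / p + 1 := by
        have h5 := Int.ceil_lt_add_one (((b : ℚ) - v) / ((p : ℤ) : ℚ))
        have h6 := Int.le_ceil (((a : ℚ) - v) / ((p : ℤ) : ℚ))
        have h7 : (((Finset.Ico a b).filter (fun x => x ≡ v [ZMOD p])).card : ℚ) =
          (⌈((b : ℚ) - v) / ((p : ℤ) : ℚ)⌉ : ℚ) - ⌈((a : ℚ) - v) / ((p : ℤ) : ℚ)⌉ := by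
            exact_mod_cast h3
        have h8 : ((b : ℚ) - a) / p = ((b : ℚ) - v) / ((p : ℤ) : ℚ) -
            ((a : ℚ) - v) / ((p : ℤ) : ℚ) := by push_cast; ring
        rw [h7, h8]
        linarith
      have h4' : (((Finset.Ico a b).filter (fun x => x ≡ v [ZMOD p])).card : ℝ) ≤
          ((b : ℝ) - a) / p + 1 := by exact_mod_cast h4
      refine h4'.trans ?_
      gcongr
    exact le_trans (by exact_mod_cast Finset.card_le_card hsub) h2

/-- Sieving by large primes: two affine forms in independent variables with the same slope are
rarely divisible by the same large prime. -/
theorem card_pairs_le {B : ℝ} (hB : 1 ≤ B) {M K : ℕ} (hM : 0 < M) {a b a' b' D c c' : ℤ}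
    (hab : (b : ℝ) - a ≤ 3 * B) (hab' : (b' : ℝ) - a' ≤ 3 * B)
    (hF : ∀ x ∈ Finset.Ico a b, (|D * x + c| : ℝ) < B ^ K) :
    {q : ℤ × ℤ | q ∈ Finset.Ico a b ×ˢ Finset.Ico a' b' ∧ ∃ p : ℕ, p.Prime ∧ M < p ∧ ¬ (p : ℤ) ∣ D ∧
      (p : ℤ) ∣ D * q.1 + c ∧ (p : ℤ) ∣ D * q.2 + c'}.ncard ≤
      16 * B ^ 2 / M + (3 + 12 * K) * B := by
  classical
  have hB0 : 0 < B := by linarith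
  -- Three cases. `E₁`: `p ≤ B`, where each coordinate lies in one class, giving `(4B/p)²` pairs,
  -- summed over `p > M`. `E₂`: the first form vanishes, which happens for at most one `x`. `E₃`: `p
  -- > B` and the first value is nonzero, so `x` admits at most `K` primes, each allowing at most
  -- `4` values of `y`.
  let W (D c a b : ℤ) (p : ℕ) : Finset ℤ := (Finset.Ico a b).filter (fun x => (p : ℤ) ∣ D * x + c)
  let P₁ : Finset ℕ := (Finset.Ioc M ⌊B⌋₊).filter (fun p => p.Prime ∧ ¬ (p : ℤ) ∣ D)
  let P₂ (x : ℤ) : Finset ℕ := (D * x + c).natAbs.primeFactors.filter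
    (fun p => B < p ∧ ¬ (p : ℤ) ∣ D)
  let E₁ : Finset (ℤ × ℤ) := P₁.biUnion fun p => W D c a b p ×ˢ W D c' a' b' p
  let I₂ : Finset ℤ := (Finset.Ico a b).filter (fun x => D ≠ 0 ∧ D * x + c = 0)
  let E₂ : Finset (ℤ × ℤ) := I₂ ×ˢ Finset.Ico a' b'
  let I₃ : Finset ℤ := (Finset.Ico a b).filter (fun x => D * x + c ≠ 0)
  let E₃ : Finset (ℤ × ℤ) := I₃.biUnion fun x => (P₂ x).biUnion fun p => {x} ×ˢ W D c' a' b' p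
  have hsub : {q : ℤ × ℤ | q ∈ Finset.Ico a b ×ˢ Finset.Ico a' b' ∧ ∃ p : ℕ, p.Prime ∧ M < p ∧ ¬ (p : ℤ) ∣ D ∧
      (p : ℤ) ∣ D * q.1 + c ∧ (p : ℤ) ∣ D * q.2 + c'} ⊆ ((E₁ ∪ (E₂ ∪ E₃) : Finset (ℤ × ℤ)) : Set _) := by
    rintro ⟨x, y⟩ ⟨hq, p, hp, hMp, hpD, h1, h2⟩
    have hq := Finset.mem_product.1 hq
    rw [Finset.mem_coe, Finset.mem_union, Finset.mem_union]
    by_cases hpB : (p : ℝ) ≤ B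
    · left
      refine Finset.mem_biUnion.2 ⟨p, Finset.mem_filter.2 ⟨Finset.mem_Ioc.2 ⟨hMp,
        Nat.le_floor hpB⟩, hp, hpD⟩, Finset.mem_product.2 ⟨?_, ?_⟩⟩
      · exact Finset.mem_filter.2 ⟨hq.1, h1⟩
      · exact Finset.mem_filter.2 ⟨hq.2, h2⟩
    · right
      by_cases h0 : D * x + c = 0
      · left
        refine Finset.mem_product.2 ⟨Finset.mem_filter.2 ⟨hq.1, ?_, h0⟩, hq.2⟩
        rintro rfl
        exact hpD (dvd_zero _)
      · right
        refine Finset.mem_biUnion.2 ⟨x, Finset.mem_filter.2 ⟨hq.1, h0⟩, Finset.mem_biUnion.2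
          ⟨p, Finset.mem_filter.2 ⟨?_, lt_of_not_ge hpB, hpD⟩, Finset.mem_product.2
            ⟨Finset.mem_singleton_self _, Finset.mem_filter.2 ⟨hq.2, h2⟩⟩⟩⟩
        exact Nat.mem_primeFactors.2 ⟨hp, Int.natCast_dvd.1 h1, Int.natAbs_ne_zero.2 h0⟩
  have hcard := (Set.ncard_le_ncard hsub (Finset.finite_toSet _))
  rw [Set.ncard_coe_finset] at hcard
  have hcard2 := hcard.trans ((Finset.card_union_le _ _).trans
    (Nat.add_le_add_left (Finset.card_union_le _ _) _))
  have h3B : (0 : ℝ) ≤ 3 * B := by positivity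
  have hE₁ : (E₁.card : ℝ) ≤ 16 * B ^ 2 / M := by
    have h1 : (E₁.card : ℝ) ≤ ∑ p ∈ P₁, 16 * B ^ 2 * ((p : ℝ) ^ 2)⁻¹ := by
      refine (Nat.cast_le.2 Finset.card_biUnion_le).trans ?_
      rw [Nat.cast_sum]
      refine Finset.sum_le_sum fun p hp => ?_
      have hp := Finset.mem_filter.1 hp
      have hpB : (p : ℝ) ≤ B := (Nat.le_floor_iff hB0.le).1 (Finset.mem_Ioc.1 hp.1).2
      have hp0 : (0 : ℝ) < p := by exact_mod_cast hp.2.1.pos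
      have h1B : 1 ≤ B / p := (one_le_div hp0).2 hpB
      have h4 : 3 * B / p + 1 ≤ 4 * (B / p) := by
        rw [mul_div_assoc]; linarith
      rw [Finset.card_product, Nat.cast_mul]
      have h5 := (card_filter_dvd_affine_le (c := c) hp.2.1 hp.2.2 h3B hab).trans h4
      have h6 := (card_filter_dvd_affine_le (c := c') hp.2.1 hp.2.2 h3B hab').trans h4
      calc ((W D c a b p).card : ℝ) * (W D c' a' b' p).card
          ≤ (4 * (B / p)) * (4 * (B / p)) := by gcongr
        _ = 16 * B ^ 2 * ((p : ℝ) ^ 2)⁻¹ := by field_simp; ring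
    refine h1.trans ?_
    rw [← Finset.mul_sum, ← mul_one_div]
    -- Primality is dropped; the sum over all integers in `(M, ⌊B⌋]` is bounded by telescoping.
    have h2 : ∑ p ∈ P₁, ((p : ℝ) ^ 2)⁻¹ ≤ 1 / M := by
      refine (Finset.sum_le_sum_of_subset_of_nonneg (Finset.filter_subset _ _)
        (fun _ _ _ => by positivity)).trans ?_
      rcases le_total M ⌊B⌋₊ with h | h
      · refine (sum_Ioc_inv_sq_le_sub hM.ne' h).trans ?_
        rw [one_div]
        have : (0 : ℝ) ≤ (⌊B⌋₊ : ℝ)⁻¹ := by positivity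
        linarith
      · rw [Finset.Ioc_eq_empty_of_le h, Finset.sum_empty]
        positivity
    gcongr
  have hE₂ : (E₂.card : ℝ) ≤ 3 * B := by
    have h1 : I₂.card ≤ 1 := by
      rw [Finset.card_le_one]
      intro x hx y hy
      have hx := (Finset.mem_filter.1 hx).2
      have hy := (Finset.mem_filter.1 hy).2
      exact mul_left_cancel₀ hx.1 (by linarith [hx.2, hy.2])
    rw [Finset.card_product, Nat.cast_mul]
    have h2 := card_Ico_le h3B hab'
    have h1' : (I₂.card : ℝ) ≤ 1 := by exact_mod_cast h1
    calc (I₂.card : ℝ) * (Finset.Ico a' b').card ≤ 1 * (3 * B) := by gcongr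
      _ = 3 * B := one_mul _
  have hE₃ : (E₃.card : ℝ) ≤ 12 * K * B := by
    have h1 : (E₃.card : ℝ) ≤ ∑ x ∈ I₃, 4 * (K : ℝ) := by
      refine (Nat.cast_le.2 Finset.card_biUnion_le).trans ?_
      rw [Nat.cast_sum]
      refine Finset.sum_le_sum fun x hx => ?_
      have hx := Finset.mem_filter.1 hx
      have h2 : (P₂ x).card ≤ K := by
        refine card_prime_divisors_le hx.2 hB (K := K) (by exact_mod_cast hF x hx.1) _ ?_
        intro p hp
        have hp := Finset.mem_filter.1 hp
        have hp' := Nat.mem_primeFactors.1 hp.1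
        exact ⟨hp'.1, hp.2.1, Int.natCast_dvd.2 hp'.2.1⟩
      have h3 : (((P₂ x).biUnion fun p => {x} ×ˢ W D c' a' b' p).card : ℝ) ≤ ∑ p ∈ P₂ x, 4 := by
        refine (Nat.cast_le.2 Finset.card_biUnion_le).trans ?_
        rw [Nat.cast_sum]
        refine Finset.sum_le_sum fun p hp => ?_
        have hp := Finset.mem_filter.1 hp
        have hp' := Nat.mem_primeFactors.1 hp.1
        rw [Finset.card_product, Finset.card_singleton, one_mul]
        refine (card_filter_dvd_affine_le (c := c') hp'.1 hp.2.2 h3B hab').trans ?_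
        have hp0 : (0 : ℝ) < p := by exact_mod_cast hp'.1.pos
        have : 3 * B / p ≤ 3 := by
          rw [div_le_iff₀ hp0]
          linarith [hp.2.1]
        linarith
      refine h3.trans ?_
      rw [Finset.sum_const, nsmul_eq_mul, mul_comm]
      gcongr
    refine h1.trans ?_
    rw [Finset.sum_const, nsmul_eq_mul]
    have h2 : (I₃.card : ℝ) ≤ 3 * B :=
      le_trans (by exact_mod_cast Finset.card_filter_le _ _) (card_Ico_le h3B hab)
    calc (I₃.card : ℝ) * (4 * K) ≤ (3 * B) * (4 * K) := by gcongr
      _ = 12 * K * B := by ring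
  have hfin : ({q : ℤ × ℤ | q ∈ Finset.Ico a b ×ˢ Finset.Ico a' b' ∧ ∃ p : ℕ, p.Prime ∧ M < p ∧
      ¬ (p : ℤ) ∣ D ∧ (p : ℤ) ∣ D * q.1 + c ∧ (p : ℤ) ∣ D * q.2 + c'}.ncard : ℝ) ≤
      E₁.card + (E₂.card + E₃.card) := by exact_mod_cast hcard2
  refine hfin.trans ?_
  linarith

end Sieve

/-! ### The sieve applied fibrewise in a cube. -/

section Sieve

variable {ι : Type*}

/-- Replace two coordinates by zero. -/
def zeroPair [DecidableEq ι] (α β : ι) (x : ι → ℤ) : ι → ℤ :=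
  fun q => if q = α ∨ q = β then 0 else x q

theorem card_Ico_cube_le {z : ℤ} {B : ℝ} (hB : 1 ≤ B) :
    ((Finset.Ico ⌈(z : ℝ) - B⌉ ⌈(z : ℝ) + B⌉).card : ℝ) ≤ 3 * B ∧
    (⌈(z : ℝ) + B⌉ : ℝ) - ⌈(z : ℝ) - B⌉ ≤ 3 * B := by
  have h1 := Int.ceil_lt_add_one ((z : ℝ) + B)
  have h2 := Int.le_ceil ((z : ℝ) - B)
  -- The length is at most `2B + 1`, and `B ≥ 1`.
  have h : (⌈(z : ℝ) + B⌉ : ℝ) - ⌈(z : ℝ) - B⌉ ≤ 3 * B := by linarith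
  exact ⟨card_Ico_le (by linarith) h, h⟩

theorem card_image_zeroPair_le [Fintype ι] [DecidableEq ι] {α β : ι} (hαβ : α ≠ β) (z : ι → ℤ)
    {B : ℝ} (hB : 1 ≤ B) (s : Finset (ι → ℤ)) (hs : s ⊆ cubeFinset z B) :
    ((s.image (zeroPair α β)).card : ℝ) ≤ (3 * B) ^ (Fintype.card ι - 2) := by
  let I (q : ι) : Finset ℤ := Finset.Ico ⌈(z q : ℝ) - B⌉ ⌈(z q : ℝ) + B⌉
  let J (q : ι) : Finset ℤ := if q = α ∨ q = β then {0} else I q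
  have hsub : s.image (zeroPair α β) ⊆ Fintype.piFinset J := by
    intro w hw
    obtain ⟨x, hx, rfl⟩ := Finset.mem_image.1 hw
    rw [Fintype.mem_piFinset]
    intro q
    have hq := Fintype.mem_piFinset.1 (hs hx) q
    by_cases h : q = α ∨ q = β
    · simp [J, zeroPair, h]
    · simpa only [J, zeroPair, h, if_false] using hq
  refine (Nat.cast_le.2 (Finset.card_le_card hsub)).trans ?_
  rw [Fintype.card_piFinset, Nat.cast_prod]
  have hc : ({α, β}ᶜ : Finset ι).card = Fintype.card ι - 2 := by
    rw [Finset.card_compl, Finset.card_pair hαβ]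
  rw [← hc, ← Finset.prod_const, ← Finset.prod_mul_prod_compl ({α, β} : Finset ι)]
  have h1 : ∏ q ∈ ({α, β} : Finset ι), ((J q).card : ℝ) = 1 := by
    refine Finset.prod_eq_one fun q hq => ?_
    rw [Finset.mem_insert, Finset.mem_singleton] at hq
    simp [J, hq]
  rw [h1, one_mul]
  refine Finset.prod_le_prod (fun _ _ => by positivity) fun q hq => ?_
  rw [Finset.mem_compl, Finset.mem_insert, Finset.mem_singleton] at hq
  simp only [J, hq, if_false]
  exact (card_Ico_cube_le hB).1

/-- Points at which two functions, affine with the same slope in two different coordinates, share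
a large prime factor not dividing the slope, are rare. -/
theorem card_common_prime_le [Fintype ι] [DecidableEq ι] {α β : ι} (hαβ : α ≠ β)
    {D f g : (ι → ℤ) → ℤ} {m : ℕ} {c : ℝ}
    (hD : ∀ x, D x = D (zeroPair α β x))
    (hf : ∀ x, f x = D (zeroPair α β x) * x α + f (zeroPair α β x))
    (hg : ∀ x, g x = D (zeroPair α β x) * x β + g (zeroPair α β x))
    (hb : ∀ (X : ℝ), 1 ≤ X → ∀ x : ι → ℤ, (∀ q, |(x q : ℝ)| ≤ X) →
      |(D x : ℝ)| * X + |(f x : ℝ)| ≤ c * X ^ m)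
    {M : ℕ} (hM : 0 < M) (z : ι → ℤ) :
    ∀ᶠ B : ℝ in atTop, (({x : ι → ℤ | ∃ p : ℕ, p.Prime ∧ M < p ∧ ¬ (p : ℤ) ∣ D x ∧
      (p : ℤ) ∣ f x ∧ (p : ℤ) ∣ g x} ∩ cube z B).ncard : ℝ) / (2 * B) ^ Fintype.card ι ≤
      (17 * 3 ^ Fintype.card ι) / M := by
  classical
  have hz : ∀ᶠ B : ℝ in atTop, ∀ q, |(z q : ℝ)| ≤ B :=
    eventually_all.2 fun q => eventually_ge_atTop _
  -- The bound on `z` puts the cube inside `[-2B, 2B]`. The threshold `c * 2 ^ m` makes `c * (2B) ^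
  -- m < B ^ (m + 1)`, so `K = m + 1` works below. The last one absorbs the linear error term into
  -- `B ^ 2 / M`, turning `16` into `17`.
  filter_upwards [hz, eventually_ge_atTop 1, eventually_gt_atTop (c * 2 ^ m),
    eventually_ge_atTop (((3 + 12 * ((m + 1 : ℕ) : ℝ))) * M)] with B hz hB hcB hBM
  have hB0 : 0 < B := by linarith
  have hM0 : (0 : ℝ) < M := by exact_mod_cast hM
  let F : Finset (ι → ℤ) := (cubeFinset z B).filter fun x => ∃ p : ℕ, p.Prime ∧ M < p ∧
    ¬ (p : ℤ) ∣ D x ∧ (p : ℤ) ∣ f x ∧ (p : ℤ) ∣ g x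
  have hF : {x : ι → ℤ | ∃ p : ℕ, p.Prime ∧ M < p ∧ ¬ (p : ℤ) ∣ D x ∧
      (p : ℤ) ∣ f x ∧ (p : ℤ) ∣ g x} ∩ cube z B = F := by
    ext x
    simp only [F, Finset.coe_filter, Set.mem_inter_iff, Set.mem_ofPred_eq, mem_cubeFinset]
    exact and_comm
  rw [hF, Set.ncard_coe_finset]
  have hbd : ∀ x ∈ cubeFinset z B, ∀ q, |(x q : ℝ)| ≤ 2 * B := by
    intro x hx q
    have h1 := (mem_cubeFinset.1 hx) q
    have h2 := abs_le.1 (hz q)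
    rw [abs_le]
    constructor <;> linarith
  -- Fixing all coordinates except `α` and `β` leaves a planar problem with constant slope `D w`.
  have hfib : ∀ w ∈ F.image (zeroPair α β), ((F.filter fun x => zeroPair α β x = w).card) ≤
      ⌊17 * B ^ 2 / M⌋₊ := by
    intro w hw
    obtain ⟨x₀, hx₀, rfl⟩ := Finset.mem_image.1 hw
    set w := zeroPair α β x₀
    have hwb : ∀ q, |(w q : ℝ)| ≤ 2 * B := by
      intro q
      simp only [w, zeroPair]
      split_ifs
      · simp; positivity
      · exact hbd _ (Finset.mem_filter.1 hx₀).1 q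
    let Q : Set (ℤ × ℤ) := {q : ℤ × ℤ | q ∈
        Finset.Ico ⌈(z α : ℝ) - B⌉ ⌈(z α : ℝ) + B⌉ ×ˢ Finset.Ico ⌈(z β : ℝ) - B⌉ ⌈(z β : ℝ) + B⌉ ∧
        ∃ p : ℕ, p.Prime ∧ M < p ∧ ¬ (p : ℤ) ∣ D w ∧ (p : ℤ) ∣ D w * q.1 + f w ∧
        (p : ℤ) ∣ D w * q.2 + g w}
    have hbw := hb (2 * B) (by linarith) w hwb
    have hpairs : (Q.ncard : ℝ) ≤ _ := card_pairs_le hB hM (K := m + 1) (D := D w) (c := f w) (c' := g w)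
      (card_Ico_cube_le (z := z α) hB).2 (card_Ico_cube_le (z := z β) hB).2 (by
        intro x hx
        have hx' : |(x : ℝ)| ≤ 2 * B := by
          rw [Finset.mem_Ico, Int.ceil_le, Int.lt_ceil] at hx
          have h2 := abs_le.1 (hz α)
          rw [abs_le]
          constructor <;> linarith
        calc |(D w : ℝ) * x + f w| ≤ |(D w : ℝ) * x| + |(f w : ℝ)| := abs_add_le _ _
          _ ≤ |(D w : ℝ)| * (2 * B) + |(f w : ℝ)| := by rw [abs_mul]; gcongr
          _ ≤ c * (2 * B) ^ m := hbw
          _ = (c * 2 ^ m) * B ^ m := by rw [mul_pow]; ring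
          _ < B * B ^ m := by gcongr
          _ = B ^ (m + 1) := by ring)
    have hinj : (F.filter fun x => zeroPair α β x = w).card ≤ Q.ncard := by
      rw [← Set.ncard_coe_finset]
      refine Set.ncard_le_ncard_of_injOn (fun x => (x α, x β)) (t := Q) ?_ ?_ ?_
      · intro x hx
        have hx := Finset.mem_filter.1 (Finset.mem_coe.1 hx)
        obtain ⟨hxc, p, hp, hMp, h1, h2, h3⟩ := Finset.mem_filter.1 hx.1
        have hxc := Fintype.mem_piFinset.1 hxc
        rw [hD, hx.2] at h1
        rw [hf, hx.2] at h2
        rw [hg, hx.2] at h3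
        exact ⟨Finset.mem_product.2 ⟨hxc α, hxc β⟩, p, hp, hMp, h1, h2, h3⟩
      · intro x hx y hy hxy
        have hx := (Finset.mem_filter.1 (Finset.mem_coe.1 hx)).2
        have hy := (Finset.mem_filter.1 (Finset.mem_coe.1 hy)).2
        have hxy := Prod.ext_iff.1 hxy
        funext q
        by_cases h : q = α ∨ q = β
        · rcases h with rfl | rfl
          · exact hxy.1
          · exact hxy.2
        · have := congrFun (hx.trans hy.symm) q
          simpa only [zeroPair, h, if_false] using this
      · exact (Finset.finite_toSet _).subset fun q hq => hq.1
    refine Nat.le_floor ((Nat.cast_le.2 hinj).trans (hpairs.trans ?_))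
    have h1 : (3 + 12 * ((m + 1 : ℕ) : ℝ)) * B ≤ B ^ 2 / M := by
      rw [le_div_iff₀ hM0]
      nlinarith
    calc _ ≤ 16 * B ^ 2 / M + B ^ 2 / M := by linarith
      _ = 17 * B ^ 2 / M := by ring
  have hcard := Finset.card_le_mul_card_image F _ hfib
  have himg := card_image_zeroPair_le hαβ z hB F (Finset.filter_subset _ _)
  have h2 : 2 ≤ Fintype.card ι := by
    have := Finset.card_le_univ ({α, β} : Finset ι)
    rwa [Finset.card_pair hαβ] at this
  have hcard' : (F.card : ℝ) ≤ (17 * B ^ 2 / M) * (3 * B) ^ (Fintype.card ι - 2) := by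
    calc (F.card : ℝ) ≤ (⌊17 * B ^ 2 / M⌋₊ : ℝ) * (F.image (zeroPair α β)).card := by
          rw [← Nat.cast_mul]
          exact Nat.cast_le.2 hcard
      _ ≤ _ := mul_le_mul (Nat.floor_le (by positivity)) himg (Nat.cast_nonneg _) (by positivity)
  rw [div_le_iff₀ (by positivity)]
  refine hcard'.trans ?_
  obtain ⟨N, hN⟩ := Nat.exists_eq_add_of_le' h2
  rw [hN, Nat.add_sub_cancel]
  calc 17 * B ^ 2 / M * (3 * B) ^ N = (17 * 3 ^ N / M) * B ^ (N + 2) := by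
        rw [mul_pow]; ring
    _ ≤ (17 * 3 ^ (N + 2) / M) * (2 * B) ^ (N + 2) := by
        gcongr
        · norm_num
        · omega
        · linarith

theorem eventually_ncard_iUnion_le [Fintype ι] {κ : Type*} [Fintype κ] {T : κ → Set (ι → ℤ)}
    {ε : ℝ} {z : ι → ℤ}
    (h : ∀ k, ∀ᶠ B : ℝ in atTop, ((T k ∩ cube z B).ncard : ℝ) / (2 * B) ^ Fintype.card ι ≤ ε) :
    ∀ᶠ B : ℝ in atTop, (((⋃ k, T k) ∩ cube z B).ncard : ℝ) / (2 * B) ^ Fintype.card ι ≤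
      Fintype.card κ * ε := by
  filter_upwards [eventually_all.2 h, eventually_gt_atTop 0] with B hB hB0
  have h1 : ((⋃ k, T k) ∩ cube z B).ncard ≤ ∑ k, (T k ∩ cube z B).ncard := by
    rw [Set.iUnion_inter]
    exact Set.ncard_iUnion_le_of_fintype _
  calc (((⋃ k, T k) ∩ cube z B).ncard : ℝ) / (2 * B) ^ Fintype.card ι
      ≤ (∑ k, ((T k ∩ cube z B).ncard : ℝ)) / (2 * B) ^ Fintype.card ι := by
        gcongr
        exact_mod_cast h1
    _ = ∑ k, ((T k ∩ cube z B).ncard : ℝ) / (2 * B) ^ Fintype.card ι := Finset.sum_div _ _ _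
    _ ≤ ∑ _k : κ, ε := Finset.sum_le_sum fun k _ => hB k
    _ = Fintype.card κ * ε := by simp

theorem eventually_ncard_mono [Fintype ι] {S T : Set (ι → ℤ)} (hST : S ⊆ T) {ε : ℝ} {z : ι → ℤ}
    (h : ∀ᶠ B : ℝ in atTop, ((T ∩ cube z B).ncard : ℝ) / (2 * B) ^ Fintype.card ι ≤ ε) :
    ∀ᶠ B : ℝ in atTop, ((S ∩ cube z B).ncard : ℝ) / (2 * B) ^ Fintype.card ι ≤ ε := by
  filter_upwards [h, eventually_gt_atTop 0] with B hB hB0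
  refine le_trans ?_ hB
  gcongr
  exact inter_cube_finite _ _ _

end Sieve

/-! ### Matrices with dependent leading columns modulo a large prime. -/

section Minors

/-- The integer matrix with a given family of entries. -/
def toMat {n : ℕ} (x : Fin n × Fin n → ℤ) : Matrix (Fin n) (Fin n) ℤ :=
  Matrix.of fun i j => x (i, j)

/-- The minor on the first `k` columns and the rows `e`. -/
def colMinor {n k : ℕ} (hk : k ≤ n) (e : Fin k → Fin n) (x : Fin n × Fin n → ℤ) : ℤ :=
  (Matrix.of fun i j : Fin k => x (e i, Fin.castLE hk j)).det

theorem colMinor_congr {n k : ℕ} (hk : k ≤ n) (e : Fin k → Fin n) {x y : Fin n × Fin n → ℤ}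
    (h : ∀ i (j : Fin n), (j : ℕ) < k → x (i, j) = y (i, j)) :
    colMinor hk e x = colMinor hk e y := by
  unfold colMinor
  congr 1
  ext i j
  exact h _ _ j.2

/-- In the expansion along column `k`, only the entry in row `r` can differ between `x` and `y`, and
its cofactor is the minor on the rows `e`, with sign `+1`. This supplies the affine forms for the
sieve, with a slope independent of `r`. -/
theorem colMinor_snoc {n k : ℕ} (hk : k + 1 ≤ n) (e : Fin k → Fin n) (r : Fin n)
    {x y : Fin n × Fin n → ℤ}
    (h : ∀ i (j : Fin n), (j : ℕ) < k ∨ i ∈ Set.range e → x (i, j) = y (i, j)) :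
    colMinor hk (Fin.snoc (α := fun _ => Fin n) e r) x =
      colMinor (Nat.le_of_succ_le hk) e y * (x (r, ⟨k, hk⟩) - y (r, ⟨k, hk⟩)) +
      colMinor hk (Fin.snoc (α := fun _ => Fin n) e r) y := by
  have hsub : ∀ (x : Fin n × Fin n → ℤ) (i : Fin (k + 1)),
      ((Matrix.of fun (i j : Fin (k + 1)) =>
        x ((Fin.snoc (α := fun _ => Fin n) e r) i, Fin.castLE hk j)).submatrix i.succAbove
          (Fin.last k).succAbove).det = colMinor (Nat.le_of_succ_le hk)
          (fun a => (Fin.snoc (α := fun _ => Fin n) e r) (i.succAbove a)) x := by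
    intro x i
    unfold colMinor
    congr 1
    ext a b
    simp [Fin.succAbove_last]
  have hcong : ∀ i : Fin (k + 1), colMinor (Nat.le_of_succ_le hk)
      (fun a => (Fin.snoc (α := fun _ => Fin n) e r) (i.succAbove a)) x =
      colMinor (Nat.le_of_succ_le hk)
      (fun a => (Fin.snoc (α := fun _ => Fin n) e r) (i.succAbove a)) y :=
    fun i => colMinor_congr _ _ fun a b hb => h a b (Or.inl hb)
  have hexp : ∀ x : Fin n × Fin n → ℤ, colMinor hk (Fin.snoc (α := fun _ => Fin n) e r) x =
      ∑ i : Fin (k + 1), (-1) ^ ((i : ℕ) + k) *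
        x ((Fin.snoc (α := fun _ => Fin n) e r) i, ⟨k, hk⟩) * colMinor (Nat.le_of_succ_le hk)
        (fun a => (Fin.snoc (α := fun _ => Fin n) e r) (i.succAbove a)) x := by
    intro x
    rw [colMinor, Matrix.det_succ_column _ (Fin.last k)]
    refine Finset.sum_congr rfl fun i _ => ?_
    rw [hsub]
    rfl
  have he : (fun a => (Fin.snoc (α := fun _ => Fin n) e r) ((Fin.last k).succAbove a)) = e := by
    funext a
    simp [Fin.succAbove_last]
  rw [hexp x, hexp y, Fin.sum_univ_castSucc, Fin.sum_univ_castSucc]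
  simp only [hcong, he, Fin.snoc_castSucc, Fin.snoc_last, Fin.val_last, Fin.val_castSucc]
  have hpow : (-1 : ℤ) ^ (k + k) = 1 := Even.neg_one_pow ⟨k, rfl⟩
  have hsum : ∀ i : Fin k, x (e i, ⟨k, hk⟩) = y (e i, ⟨k, hk⟩) := fun i => h _ _ (Or.inr ⟨i, rfl⟩)
  simp only [hsum, hpow]
  rw [colMinor_congr (x := x) (y := y) _ e fun a b hb => h a b (Or.inl hb)]
  ring

theorem abs_colMinor_le {n k : ℕ} (hk : k ≤ n) (e : Fin k → Fin n) (x : Fin n × Fin n → ℤ) {X : ℝ}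
    (hx : ∀ q, |(x q : ℝ)| ≤ X) : |(colMinor hk e x : ℝ)| ≤ k.factorial * X ^ k := by
  have h := Matrix.det_le (A := (Matrix.of fun i j : Fin k => (x (e i, Fin.castLE hk j) : ℝ)))
    (abv := AbsoluteValue.abs) (x := X) (fun i j => hx _)
  rw [Fintype.card_fin, nsmul_eq_mul] at h
  refine le_trans (le_of_eq ?_) h
  have : (colMinor hk e x : ℝ) =
      (Matrix.of fun i j : Fin k => (x (e i, Fin.castLE hk j) : ℝ)).det := by
    rw [colMinor, ← eq_intCast (Int.castRingHom ℝ), RingHom.map_det]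
    rfl
  rw [this]
  rfl

theorem exists_pair_notMem_range {n k : ℕ} (hk : k + 1 < n) (e : Fin k → Fin n) :
    ∃ r s : Fin n, r ≠ s ∧ r ∉ Set.range e ∧ s ∉ Set.range e := by
  have h1 : 1 < ((Finset.univ.image e)ᶜ).card := by
    have := Finset.card_image_le (s := Finset.univ) (f := e)
    rw [Finset.card_univ, Fintype.card_fin] at this
    rw [Finset.card_compl, Fintype.card_fin]
    omega
  obtain ⟨r, hr, s, hs, hrs⟩ := Finset.one_lt_card.1 h1
  exact ⟨r, s, hrs, by simpa using hr, by simpa using hs⟩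

/-- The minors of an `(m + 1) × (m + 1)` matrix on its first `m` columns. -/
def leadMinor {R : Type*} [CommRing R] {m : ℕ} (V : Matrix (Fin (m + 1)) (Fin (m + 1)) R)
    (i : Fin (m + 1)) : R :=
  (V.submatrix i.succAbove Fin.castSucc).det

/-- Let `P k` say that `p` divides every minor on the first `k` columns. `P 0` fails because the
empty determinant is `1`, and `P m` holds because such a minor is a signed `leadMinor` or has a
repeated row. Some `k < m` therefore has `P (k + 1)` but not `P k`. -/
theorem exists_colMinor_of_dvd_leadMinor {m p : ℕ} (hp : p.Prime)
    (x : Fin (m + 1) × Fin (m + 1) → ℤ) (h : ∀ i, (p : ℤ) ∣ leadMinor (toMat x) i) :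
    ∃ (k : Fin m) (e : Fin k → Fin (m + 1)),
      ¬ (p : ℤ) ∣ colMinor (Nat.le_succ_of_le k.2.le) e x ∧
      ∀ r, (p : ℤ) ∣ colMinor (Nat.succ_le_succ k.2.le)
        (Fin.snoc (α := fun _ => Fin (m + 1)) e r) x := by
  let P (k : ℕ) : Prop := ∀ (hk : k ≤ m + 1) (e : Fin k → Fin (m + 1)), (p : ℤ) ∣ colMinor hk e x
  have hPm : P m := by
    intro hk e
    by_cases he : Function.Injective e
    · obtain ⟨i, hi⟩ : ∃ i, i ∉ Set.range e := by
        by_contra! hall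
        have := Fintype.card_le_of_surjective e fun i => hall i
        simp at this
      have hi' : ∀ a, e a ≠ i := fun a ha => hi ⟨a, ha⟩
      choose σ hσ using fun a => Fin.exists_succAbove_eq (hi' a)
      have hσi : Function.Injective σ := fun a b hab => he (by rw [← hσ a, ← hσ b, hab])
      let τ : Equiv.Perm (Fin m) := Equiv.ofBijective σ (Finite.injective_iff_bijective.1 hσi)
      have : colMinor hk e x = Equiv.Perm.sign τ * leadMinor (toMat x) i := by
        rw [leadMinor, ← Int.cast_id (n := (Equiv.Perm.sign τ : ℤ)), ← Matrix.det_permute]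
        unfold colMinor
        congr 1
        ext a b
        simp only [Matrix.of_apply, Matrix.submatrix_apply, toMat, id, τ,
          Equiv.ofBijective_apply, hσ]
        rfl
      rw [this]
      exact Dvd.dvd.mul_left (h i) _
    · rw [Function.Injective] at he
      push Not at he
      obtain ⟨a, b, hab, hne⟩ := he
      rw [colMinor, Matrix.det_zero_of_row_eq hne]
      · exact dvd_zero _
      · funext j
        simp [hab]
  have hP0 : ¬ P 0 := by
    intro h0
    have := h0 (Nat.zero_le _) Fin.elim0
    rw [colMinor, Matrix.det_isEmpty] at this
    exact hp.one_lt.ne' (by simpa using Int.natAbs_dvd_natAbs.2 this)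
  obtain ⟨k, hkm, hk, hk1⟩ : ∃ k < m, ¬ P k ∧ P (k + 1) := by
    by_contra! hall
    have : ∀ k ≤ m, ¬ P k := by
      intro k
      induction k with
      | zero => exact fun _ => hP0
      | succ k ih => exact fun hk => hall k hk (ih (Nat.le_of_succ_le hk))
    exact this m le_rfl hPm
  simp only [P] at hk
  push Not at hk
  obtain ⟨hk', e, he⟩ := hk
  exact ⟨⟨k, hkm⟩, e, he, fun r => hk1 _ _⟩

/-- Matrices whose first `m` columns are dependent modulo some prime larger than `M`. -/
def degenerateAbove (m M : ℕ) : Set (Fin (m + 1) × Fin (m + 1) → ℤ) :=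
  {x | ∃ p : ℕ, p.Prime ∧ M < p ∧ ∀ i, (p : ℤ) ∣ leadMinor (toMat x) i}

/-- There are finitely many choices of `k` and `e`. As `k < m`, two rows `r ≠ s` lie outside `e`;
the entries `(r, k)` and `(s, k)` are the two free coordinates of the sieve. -/
theorem exists_density_degenerateAbove_le (m : ℕ) : ∃ C : ℝ, ∀ M : ℕ, 0 < M →
    ∀ z : Fin (m + 1) × Fin (m + 1) → ℤ, ∀ᶠ B : ℝ in atTop,
      ((degenerateAbove m M ∩ cube z B).ncard : ℝ) /
        (2 * B) ^ Fintype.card (Fin (m + 1) × Fin (m + 1)) ≤ C / M := by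
  let κ := Σ k : Fin m, (Fin k → Fin (m + 1))
  refine ⟨Fintype.card κ * (17 * 3 ^ Fintype.card (Fin (m + 1) × Fin (m + 1))),
    fun M hM z => ?_⟩
  choose r s hrs hr hs using fun a : κ =>
    exists_pair_notMem_range (Nat.succ_lt_succ a.1.2) a.2
  let D (a : κ) := colMinor (Nat.le_succ_of_le a.1.2.le) a.2
  let f (t : Fin (m + 1)) (a : κ) := colMinor (Nat.succ_le_succ a.1.2.le)
    (Fin.snoc (α := fun _ => Fin (m + 1)) a.2 t)
  have hsub : degenerateAbove m M ⊆ ⋃ a : κ, {x | ∃ p : ℕ, p.Prime ∧ M < p ∧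
      ¬ (p : ℤ) ∣ D a x ∧ (p : ℤ) ∣ f (r a) a x ∧ (p : ℤ) ∣ f (s a) a x} := by
    rintro x ⟨p, hp, hMp, hx⟩
    obtain ⟨k, e, h1, h2⟩ := exists_colMinor_of_dvd_leadMinor hp x hx
    exact Set.mem_iUnion.2 ⟨⟨k, e⟩, p, hp, hMp, h1, h2 _, h2 _⟩
  rw [mul_div_assoc]
  refine eventually_ncard_mono hsub (eventually_ncard_iUnion_le fun a => ?_)
  have hka : (a.1 : ℕ) < m + 1 := Nat.lt_succ_of_lt a.1.2
  have hz : ∀ x (i : Fin (m + 1)) (j : Fin (m + 1)), (j : ℕ) < a.1 ∨ i ∈ Set.range a.2 →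
      x (i, j) = zeroPair (r a, ⟨a.1, hka⟩) (s a, ⟨a.1, hka⟩) x (i, j) := by
    intro x i j hij
    rw [zeroPair, if_neg]
    rintro (h | h) <;> rw [Prod.mk.injEq] at h <;> obtain ⟨rfl, rfl⟩ := h <;>
      rcases hij with hij | hij
    · exact lt_irrefl _ hij
    · exact hr a hij
    · exact lt_irrefl _ hij
    · exact hs a hij
  refine card_common_prime_le (α := (r a, ⟨a.1, hka⟩)) (β := (s a, ⟨a.1, hka⟩))
    (m := m) (c := 2 * m.factorial) ?_ ?_ ?_ ?_ ?_ hM z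
  · intro h
    exact hrs a (Prod.mk.inj h).1
  · intro x
    exact colMinor_congr _ _ fun i j hj => hz x i j (Or.inl hj)
  · intro x
    refine (colMinor_snoc _ _ _ (hz x)).trans ?_
    simp only [zeroPair, true_or, if_true, sub_zero]
    rfl
  · intro x
    refine (colMinor_snoc _ _ _ (hz x)).trans ?_
    simp only [zeroPair, or_true, if_true, sub_zero]
    rfl
  · intro X hX x hx
    have h1 := abs_colMinor_le (Nat.le_succ_of_le a.1.2.le) a.2 x hx
    have h2 := abs_colMinor_le (Nat.succ_le_succ a.1.2.le)
      (Fin.snoc (α := fun _ => Fin (m + 1)) a.2 (r a)) x hx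
    have hX0 : 0 ≤ X := by linarith
    have h3 : ((a.1 : ℕ).factorial : ℝ) * X ^ (a.1 : ℕ) * X ≤ m.factorial * X ^ m := by
      rw [mul_assoc, ← pow_succ]
      have : ((a.1 : ℕ).factorial : ℝ) ≤ m.factorial :=
        Nat.cast_le.2 (Nat.factorial_le a.1.2.le)
      gcongr
      exact a.1.2
    have h4 : (((a.1 : ℕ) + 1).factorial : ℝ) * X ^ ((a.1 : ℕ) + 1) ≤ m.factorial * X ^ m := by
      have : ((((a.1 : ℕ) + 1).factorial : ℕ) : ℝ) ≤ m.factorial :=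
        Nat.cast_le.2 (Nat.factorial_le a.1.2)
      gcongr
      exact a.1.2
    calc _ ≤ ((a.1 : ℕ).factorial : ℝ) * X ^ (a.1 : ℕ) * X +
          (((a.1 : ℕ) + 1).factorial : ℝ) * X ^ ((a.1 : ℕ) + 1) := by
          gcongr
      _ ≤ 2 * m.factorial * X ^ m := by linarith

end Minors

/-! ### Local densities at finitely many primes. -/

section LocalDensity

/-- For the converse, independent columns extend by a vector outside their span to an invertible
matrix; expanding its determinant along the new column produces a nonzero minor. -/
theorem exists_leadMinor_ne_zero_iff {K : Type*} [Field K] {m : ℕ}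
    (V : Matrix (Fin (m + 1)) (Fin (m + 1)) K) :
    (∃ i, leadMinor V i ≠ 0) ↔ LinearIndependent K (fun (j : Fin m) i => V i j.castSucc) := by
  constructor
  · rintro ⟨i, hi⟩
    have h1 : LinearIndependent K (V.submatrix i.succAbove Fin.castSucc).col :=
      Matrix.linearIndependent_cols_iff_isUnit.2
        ((Matrix.isUnit_iff_isUnit_det _).2 (isUnit_iff_ne_zero.2 hi))
    exact LinearIndependent.of_comp (LinearMap.funLeft K K i.succAbove) h1
  · intro h
    by_contra! hall
    obtain ⟨w, hw⟩ : ∃ w, w ∉ Submodule.span K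
        (Set.range fun (j : Fin m) i => V i j.castSucc) := by
      by_contra! hw
      have h2 := finrank_span_eq_card h
      rw [(Submodule.eq_top_iff').2 hw, finrank_top, Module.finrank_fin_fun, Fintype.card_fin] at h2
      omega
    have h3 : LinearIndependent K (Fin.snoc (α := fun _ => Fin (m + 1) → K)
        (fun (j : Fin m) i => V i j.castSucc) w) :=
      linearIndependent_finSnoc.2 ⟨h, hw⟩
    let W : Matrix (Fin (m + 1)) (Fin (m + 1)) K :=
      Matrix.of fun i j => Fin.snoc (α := fun _ => Fin (m + 1) → K)
        (fun (j : Fin m) i => V i j.castSucc) w j i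
    have h4 : IsUnit W := Matrix.linearIndependent_cols_iff_isUnit.1 h3
    have h5 := ((Matrix.isUnit_iff_isUnit_det _).1 h4).ne_zero
    apply h5
    rw [Matrix.det_succ_column W (Fin.last m)]
    refine Finset.sum_eq_zero fun i _ => ?_
    have : (W.submatrix i.succAbove (Fin.last m).succAbove) =
        V.submatrix i.succAbove Fin.castSucc := by
      ext a b
      simp [W, Fin.succAbove_last]
    rw [this]
    exact mul_eq_zero_of_right _ (hall i)

/-- Square matrices of size `m + 1` with a nonzero minor on the first `m` columns. -/
def leadRegular (m : ℕ) (R : Type*) [CommRing R] : Set (Fin (m + 1) × Fin (m + 1) → R) :=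
  {x | ∃ i, leadMinor (Matrix.of fun i j => x (i, j)) i ≠ 0}

theorem ncard_leadRegular (m : ℕ) (K : Type*) [Field K] [Fintype K] :
    (leadRegular m K).ncard =
      (∏ i : Fin m, (Fintype.card K ^ (m + 1) - Fintype.card K ^ (i : ℕ))) *
        Fintype.card K ^ (m + 1) := by
  let e : (Fin m → Fin (m + 1) → K) × (Fin (m + 1) → K) → (Fin (m + 1) × Fin (m + 1) → K) :=
    fun s q => Fin.snoc (α := fun _ => Fin (m + 1) → K) s.1 s.2 q.2 q.1
  have he : Function.Injective e := by
    rintro ⟨s, w⟩ ⟨s', w'⟩ h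
    rw [Prod.mk.injEq]
    constructor
    · funext j i
      simpa [e] using congrFun h (i, j.castSucc)
    · funext i
      simpa [e] using congrFun h (i, Fin.last m)
  have himg : leadRegular m K = e '' ({s | LinearIndependent K s} ×ˢ Set.univ) := by
    ext x
    rw [leadRegular, Set.mem_ofPred_eq, exists_leadMinor_ne_zero_iff]
    constructor
    · intro h
      refine ⟨(fun j i => x (i, j.castSucc), fun i => x (i, Fin.last m)), ⟨h, trivial⟩, ?_⟩
      funext ⟨i, j⟩
      refine Fin.lastCases ?_ (fun j => ?_) j <;> simp [e]
    · rintro ⟨⟨s, w⟩, ⟨h, -⟩, rfl⟩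
      simpa [e] using h
  rw [himg, Set.ncard_image_of_injective _ he, Set.ncard_prod, Set.ncard_univ,
    Nat.card_eq_fintype_card, Fintype.card_fun, Fintype.card_fin]
  congr 1
  have h := card_linearIndependent (K := K) (V := Fin (m + 1) → K) (k := m)
    (by rw [Module.finrank_fin_fun]; exact Nat.le_succ m)
  rw [Module.finrank_fin_fun] at h
  exact h

/-- The free last column cancels, and the factor for column `i < m` is `1 - p ^ (-(m + 1 - i))`. The
exponents run from `m + 1` down to `2`, which is why the zeta product starts at `2`. -/
theorem ncard_leadRegular_div (m p : ℕ) [Fact p.Prime] :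
    ((leadRegular m (ZMod p)).ncard : ℝ) / Nat.card (Fin (m + 1) × Fin (m + 1) → ZMod p) =
      ∏ k ∈ Finset.Icc 2 (m + 1), (1 - ((p : ℝ) ^ k)⁻¹) := by
  have hp := (Fact.out : p.Prime).pos
  have hp0 : (0 : ℝ) < p := by exact_mod_cast hp
  rw [ncard_leadRegular, ZMod.card, Nat.card_eq_fintype_card, Fintype.card_fun, ZMod.card,
    Fintype.card_prod, Fintype.card_fin, Nat.cast_mul, Nat.cast_prod, pow_mul, pow_succ (p ^ (m + 1)) m,
    Nat.cast_mul, mul_div_mul_right _ _ (by positivity)]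
  have h1 : (((p ^ (m + 1)) ^ m : ℕ) : ℝ) = ∏ _i : Fin m, ((p : ℝ) ^ (m + 1)) := by
    simp
  rw [h1, ← Finset.prod_div_distrib]
  have h2 : ∀ i : Fin m, ((p ^ (m + 1) - p ^ (i : ℕ) : ℕ) : ℝ) / (p : ℝ) ^ (m + 1) =
      1 - ((p : ℝ) ^ (m + 1 - (i : ℕ)))⁻¹ := by
    intro i
    have hi : (i : ℕ) ≤ m + 1 := by omega
    rw [Nat.cast_sub (Nat.pow_le_pow_right hp hi), Nat.cast_pow, Nat.cast_pow, sub_div,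
      div_self (by positivity)]
    congr 1
    rw [pow_sub₀ _ hp0.ne' hi, mul_inv, inv_inv, mul_comm, div_eq_mul_inv]
  rw [Finset.prod_congr rfl fun i _ => h2 i]
  rw [Fin.prod_univ_eq_prod_range (fun i => 1 - ((p : ℝ) ^ (m + 1 - i))⁻¹) m]
  refine Finset.prod_bij' (fun i _ => m + 1 - i) (fun k _ => m + 1 - k) ?_ ?_ ?_ ?_ ?_
  · intro i hi
    rw [Finset.mem_range] at hi
    rw [Finset.mem_Icc]
    omega
  · intro k hk
    rw [Finset.mem_Icc] at hk
    rw [Finset.mem_range]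
    omega
  · intro i hi
    rw [Finset.mem_range] at hi
    omega
  · intro k hk
    rw [Finset.mem_Icc] at hk
    omega
  · intro i _
    rfl

theorem intCast_mem_leadRegular {m p : ℕ} (x : Fin (m + 1) × Fin (m + 1) → ℤ) :
    (fun q => (x q : ZMod p)) ∈ leadRegular m (ZMod p) ↔
      ∃ i, ¬ (p : ℤ) ∣ leadMinor (toMat x) i := by
  refine exists_congr fun i => not_congr ?_
  rw [← ZMod.intCast_zmod_eq_zero_iff_dvd, leadMinor, leadMinor, ← eq_intCast (Int.castRingHom _),
    RingHom.map_det]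
  rfl

/-- Reduction modulo all primes of a finite set. -/
def reduceMod (ι : Type*) (P : Finset ℕ) : (ι → ℤ) →+ ((p : P) → ι → ZMod p) where
  toFun x p i := (x i : ZMod p)
  map_zero' := by ext; simp
  map_add' x y := by ext; simp

theorem reduceMod_surjective (ι : Type*) (P : Finset ℕ) (hP : ∀ p ∈ P, p.Prime) :
    Function.Surjective (reduceMod ι P) := by
  intro g
  have hco : Pairwise fun p q : P => Nat.Coprime p q := fun p q hpq =>
    (Nat.coprime_primes (hP p p.2) (hP q q.2)).2 fun h => hpq (Subtype.ext h)
  have hne : ∀ p : P, NeZero (p : ℕ) := fun p => ⟨(hP p p.2).ne_zero⟩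
  have key : ∀ i, ∃ a : ℤ, ∀ p : P, (a : ZMod p) = g p i := by
    intro i
    let b := (ZMod.prodEquivPi (fun p : P => (p : ℕ)) hco).symm fun p => g p i
    obtain ⟨a, ha⟩ := ZMod.intCast_surjective b
    refine ⟨a, fun p => ?_⟩
    have := (ZMod.prodEquivPi (fun p : P => (p : ℕ)) hco).apply_symm_apply fun p => g p i
    change ZMod.prodEquivPi (fun p : P => (p : ℕ)) hco b = _ at this
    rw [← ha, map_intCast] at this
    exact congrFun this p
  choose a ha using key
  exact ⟨a, by ext p i; exact ha i p⟩

/-- The proportion of matrices whose first `m` columns are independent modulo each prime of a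
finite set. -/
theorem card_leadRegular_pi (m : ℕ) (P : Finset ℕ) (hP : ∀ p ∈ P, p.Prime) :
    (({g : (p : P) → Fin (m + 1) × Fin (m + 1) → ZMod p |
      ∀ p : P, g p ∈ leadRegular m (ZMod p)}.ncard : ℝ) /
      Nat.card ((p : P) → Fin (m + 1) × Fin (m + 1) → ZMod p)) =
      ∏ p ∈ P, ∏ k ∈ Finset.Icc 2 (m + 1), (1 - ((p : ℝ) ^ k)⁻¹) := by
  classical
  have hF : ∀ p : P, Fact (p : ℕ).Prime := fun p => ⟨hP p p.2⟩
  have h1 : {g : (p : P) → Fin (m + 1) × Fin (m + 1) → ZMod p |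
      ∀ p : P, g p ∈ leadRegular m (ZMod p)} =
      (Fintype.piFinset fun p : P => (leadRegular m (ZMod p)).toFinset : Set _) := by
    ext g
    simp [Set.mem_pi]
  rw [h1, Set.ncard_coe_finset, Fintype.card_piFinset, Nat.card_pi, Nat.cast_prod, Nat.cast_prod,
    ← Finset.prod_div_distrib, ← Finset.prod_coe_sort P]
  refine Finset.prod_congr rfl fun p _ => ?_
  rw [← ncard_leadRegular_div m p, Set.ncard_eq_toFinset_card']

end LocalDensity

/-! ### Euler products and the limit over primes. -/

section EulerProduct

theorem tendsto_euler_realZeta {k : ℕ} (hk : 2 ≤ k) :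
    Tendsto (fun M : ℕ => ∏ p ∈ M.primesBelow, (1 - ((p : ℝ) ^ k)⁻¹)⁻¹) atTop
      (𝓝 (realZeta k)) := by
  have h := riemannZeta_eulerProduct (s := k) (by simp; omega)
  have h2 := (Complex.continuous_re.tendsto _).comp h
  refine h2.congr fun M => ?_
  have : (∏ p ∈ M.primesBelow, (1 - (p : ℂ) ^ (-(k : ℂ)))⁻¹) =
      ((∏ p ∈ M.primesBelow, (1 - ((p : ℝ) ^ k)⁻¹)⁻¹ : ℝ) : ℂ) := by
    push_cast
    refine Finset.prod_congr rfl fun p _ => ?_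
    rw [Complex.cpow_neg, Complex.cpow_natCast]
  rw [Function.comp_apply, this, Complex.ofReal_re]

theorem realZeta_ne_zero {k : ℕ} (hk : 2 ≤ k) : realZeta k ≠ 0 := by
  have h1 : 1 ≤ realZeta k := by
    refine ge_of_tendsto (tendsto_euler_realZeta hk) (Eventually.of_forall fun M => ?_)
    refine Finset.one_le_prod fun p hp => ?_
    have hp := (Nat.prime_of_mem_primesBelow hp)
    have h2 : (1 : ℝ) < (p : ℝ) ^ k :=
      one_lt_pow₀ (by exact_mod_cast hp.one_lt) (by omega)
    have h3 := inv_lt_one_of_one_lt₀ h2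
    have h4 : (0 : ℝ) ≤ ((p : ℝ) ^ k)⁻¹ := by positivity
    exact (one_le_inv₀ (by linarith)).2 (by linarith)
  linarith

theorem tendsto_prod_local (m : ℕ) :
    Tendsto (fun M : ℕ => ∏ p ∈ (M + 1).primesBelow, ∏ k ∈ Finset.Icc 2 (m + 1),
      (1 - ((p : ℝ) ^ k)⁻¹)) atTop (𝓝 (∏ k ∈ Finset.Icc 2 (m + 1), realZeta k)⁻¹) := by
  have h := tendsto_finsetProd (Finset.Icc 2 (m + 1)) fun k hk =>
    ((tendsto_euler_realZeta (Finset.mem_Icc.1 hk).1).comp (tendsto_add_atTop_nat 1)).inv₀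
      (realZeta_ne_zero (Finset.mem_Icc.1 hk).1)
  rw [Finset.prod_inv_distrib] at h
  refine h.congr fun M => ?_
  rw [Finset.prod_comm]
  refine Finset.prod_congr rfl fun k _ => ?_
  rw [Function.comp_apply, Finset.prod_inv_distrib, inv_inv]

end EulerProduct

/-! ### Bordered matrices and primitivity. -/

section Bordered

variable {m : ℕ}

/-- The block matrix `[[H, c], [0, t]]`. -/
def bord (H : Matrix (Fin m) (Fin m) ℤ) (c : Fin m → ℤ) (t : ℤ) :
    Matrix (Fin (m + 1)) (Fin (m + 1)) ℤ :=
  Matrix.of <| Fin.snoc (α := fun _ => Fin (m + 1) → ℤ)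
    (fun i => Fin.snoc (α := fun _ => ℤ) (H i) (c i)) (Fin.snoc (α := fun _ => ℤ) 0 t)

@[simp] theorem bord_castSucc_castSucc (H : Matrix (Fin m) (Fin m) ℤ) (c : Fin m → ℤ) (t : ℤ)
    (i j : Fin m) : bord H c t i.castSucc j.castSucc = H i j := by
  simp [bord]

@[simp] theorem bord_castSucc_last (H : Matrix (Fin m) (Fin m) ℤ) (c : Fin m → ℤ) (t : ℤ)
    (i : Fin m) : bord H c t i.castSucc (Fin.last m) = c i := by
  simp [bord]

@[simp] theorem bord_last_castSucc (H : Matrix (Fin m) (Fin m) ℤ) (c : Fin m → ℤ) (t : ℤ)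
    (j : Fin m) : bord H c t (Fin.last m) j.castSucc = 0 := by
  simp [bord]

@[simp] theorem bord_last_last (H : Matrix (Fin m) (Fin m) ℤ) (c : Fin m → ℤ) (t : ℤ) :
    bord H c t (Fin.last m) (Fin.last m) = t := by
  simp [bord]

theorem bord_ext {A : Matrix (Fin (m + 1)) (Fin (m + 1)) ℤ} {H : Matrix (Fin m) (Fin m) ℤ}
    {c : Fin m → ℤ} {t : ℤ} (h1 : ∀ i j, A (Fin.castSucc i) (Fin.castSucc j) = H i j)
    (h2 : ∀ i, A (Fin.castSucc i) (Fin.last m) = c i)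
    (h3 : ∀ j, A (Fin.last m) (Fin.castSucc j) = 0) (h4 : A (Fin.last m) (Fin.last m) = t) :
    A = bord H c t := by
  ext i j
  refine Fin.lastCases ?_ (fun i => ?_) i <;> refine Fin.lastCases ?_ (fun j => ?_) j <;>
    simp [h1, h2, h3, h4]

theorem mul_bord_castSucc (V : Matrix (Fin (m + 1)) (Fin (m + 1)) ℤ) (H : Matrix (Fin m) (Fin m) ℤ)
    (c : Fin m → ℤ) (t : ℤ) (i : Fin (m + 1)) (j : Fin m) :
    (V * bord H c t) i j.castSucc = ∑ k : Fin m, V i k.castSucc * H k j := by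
  simp [Matrix.mul_apply, Fin.sum_univ_castSucc]

theorem mul_bord_last (V : Matrix (Fin (m + 1)) (Fin (m + 1)) ℤ) (H : Matrix (Fin m) (Fin m) ℤ)
    (c : Fin m → ℤ) (t : ℤ) (i : Fin (m + 1)) :
    (V * bord H c t) i (Fin.last m) = ∑ k : Fin m, V i k.castSucc * c k + V i (Fin.last m) * t := by
  simp [Matrix.mul_apply, Fin.sum_univ_castSucc]

/-- These row operations add multiples of the last row to the others and scale it by `s`: the means
of reducing the last column. -/
theorem bord_one_mul_bord (H : Matrix (Fin m) (Fin m) ℤ) (c q : Fin m → ℤ) (s t : ℤ) :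
    bord 1 q s * bord H c t = bord H (c + t • q) (s * t) := by
  refine bord_ext ?_ ?_ ?_ ?_
  · intro i j
    simp [mul_bord_castSucc, Matrix.one_apply]
  · intro i
    simp [mul_bord_last, Matrix.one_apply, mul_comm]
  · intro j
    simp [mul_bord_castSucc]
  · simp [mul_bord_last]

theorem det_bord (H : Matrix (Fin m) (Fin m) ℤ) (c : Fin m → ℤ) (t : ℤ) :
    (bord H c t).det = H.det * t := by
  rw [Matrix.det_succ_row _ (Fin.last m), Fin.sum_univ_castSucc]
  have : (bord H c t).submatrix (Fin.last m).succAbove (Fin.last m).succAbove = H := by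
    ext i j
    simp [Fin.succAbove_last]
  rw [this]
  simp [Even.neg_one_pow ⟨m, rfl⟩, mul_comm]

theorem leadMinor_mul_bord (V : Matrix (Fin (m + 1)) (Fin (m + 1)) ℤ)
    (H : Matrix (Fin m) (Fin m) ℤ) (c : Fin m → ℤ) (t : ℤ) (i : Fin (m + 1)) :
    leadMinor (V * bord H c t) i = leadMinor V i * H.det := by
  rw [leadMinor, leadMinor, ← Matrix.det_mul]
  congr 1
  ext a b
  rw [Matrix.submatrix_apply, mul_bord_castSucc, Matrix.mul_apply]
  rfl

theorem leadMinor_congr {R : Type*} [CommRing R] {V W : Matrix (Fin (m + 1)) (Fin (m + 1)) R}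
    (h : ∀ i (j : Fin m), V i j.castSucc = W i j.castSucc) (i : Fin (m + 1)) :
    leadMinor V i = leadMinor W i := by
  unfold leadMinor
  congr 1
  ext a b
  exact h _ _

theorem det_eq_sum_leadMinor {R : Type*} [CommRing R] (V : Matrix (Fin (m + 1)) (Fin (m + 1)) R) :
    V.det = ∑ i : Fin (m + 1), (-1) ^ ((i : ℕ) + m) * V i (Fin.last m) * leadMinor V i := by
  rw [Matrix.det_succ_column V (Fin.last m)]
  refine Finset.sum_congr rfl fun i _ => ?_
  rw [Fin.val_last, leadMinor]
  congr 2
  ext a b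
  simp [Fin.succAbove_last]

/-- The first `m` columns extend to a unimodular matrix. -/
def IsPrim (V : Matrix (Fin (m + 1)) (Fin (m + 1)) ℤ) : Prop :=
  ∃ U : Matrix.GeneralLinearGroup (Fin (m + 1)) ℤ, ∀ i (j : Fin m),
    (U : Matrix (Fin (m + 1)) (Fin (m + 1)) ℤ) i j.castSucc = V i j.castSucc

/-- A unimodular determinant is a combination of these minors, so no prime divides them all.
Conversely, if none does, they generate the unit ideal, and Bézout coefficients provide a last
column making the determinant `1`. -/
theorem isPrim_iff {V : Matrix (Fin (m + 1)) (Fin (m + 1)) ℤ} :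
    IsPrim V ↔ ∀ p : ℕ, p.Prime → ∃ i, ¬ (p : ℤ) ∣ leadMinor V i := by
  constructor
  · rintro ⟨U, hU⟩ p hp
    by_contra! hall
    have h1 : (p : ℤ) ∣ (U : Matrix (Fin (m + 1)) (Fin (m + 1)) ℤ).det := by
      rw [det_eq_sum_leadMinor]
      refine Finset.dvd_sum fun i _ => Dvd.dvd.mul_left ?_ _
      rw [leadMinor_congr hU]
      exact hall i
    have h2 : IsUnit (U : Matrix (Fin (m + 1)) (Fin (m + 1)) ℤ).det :=
      (Matrix.isUnit_iff_isUnit_det _).1 U.isUnit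
    exact (Nat.prime_iff_prime_int.1 hp).not_isUnit (isUnit_of_dvd_unit h1 h2)
  · intro h
    let I : Ideal ℤ := Ideal.span (Set.range (leadMinor V))
    let g : ℤ := Submodule.IsPrincipal.generator I
    have hg : ∀ i, g ∣ leadMinor V i := fun i =>
      (Submodule.IsPrincipal.mem_iff_generator_dvd I).1 (Ideal.subset_span ⟨i, rfl⟩)
    have hg1 : g.natAbs = 1 := by
      by_contra hne
      obtain ⟨p, hp, hpg⟩ := Nat.exists_prime_and_dvd hne
      obtain ⟨i, hi⟩ := h p hp
      exact hi ((Int.natCast_dvd.2 hpg).trans (hg i))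
    have h1 : (1 : ℤ) ∈ I :=
      (Submodule.IsPrincipal.mem_iff_generator_dvd I).2 (Int.isUnit_iff_natAbs_eq.2 hg1).dvd
    obtain ⟨w, hw⟩ := (Ideal.mem_span_range_iff_exists_fun).1 h1
    -- The signs cancel the cofactor signs of the expansion along the last column.
    let W : Matrix (Fin (m + 1)) (Fin (m + 1)) ℤ := Matrix.of fun i =>
      Fin.snoc (α := fun _ => ℤ) (fun j : Fin m => V i j.castSucc) ((-1) ^ ((i : ℕ) + m) * w i)
    have hWV : ∀ i (j : Fin m), W i j.castSucc = V i j.castSucc := by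
      intro i j
      simp [W]
    have hdet : W.det = 1 := by
      rw [det_eq_sum_leadMinor]
      refine Eq.trans ?_ hw
      refine Finset.sum_congr rfl fun i _ => ?_
      rw [leadMinor_congr hWV]
      have : ((-1 : ℤ) ^ ((i : ℕ) + m)) * (-1) ^ ((i : ℕ) + m) = 1 := by
        rw [← mul_pow]; simp
      simp only [W, Matrix.of_apply, Fin.snoc_last, ← mul_assoc, this, one_mul]
    exact ⟨Matrix.GeneralLinearGroup.mk'' W (by rw [hdet]; exact isUnit_one), hWV⟩

end Bordered

/-! ### Hermite blocks with a given diagonal: count and uniqueness. -/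

section Blocks

variable {m : ℕ}

/-- Nonsingular square matrices in Hermite normal form with a given diagonal. -/
noncomputable def hnfBlocks (d : Fin m → ℕ) : Finset (Matrix (Fin m) (Fin m) ℤ) :=
  (Fintype.piFinset fun i => Fintype.piFinset fun j =>
    if i < j then Finset.Ico (0 : ℤ) (d j) else if i = j then {(d j : ℤ)} else {0}).map
    Matrix.of.toEmbedding

theorem mem_hnfBlocks {d : Fin m → ℕ} {H : Matrix (Fin m) (Fin m) ℤ} :
    H ∈ hnfBlocks d ↔ (∀ i j, j < i → H i j = 0) ∧ (∀ j, H j j = d j) ∧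
      ∀ i j, i < j → 0 ≤ H i j ∧ H i j < d j := by
  rw [hnfBlocks, Finset.mem_map_equiv]
  simp only [Fintype.mem_piFinset, Matrix.of_symm_apply]
  constructor
  · intro h
    refine ⟨fun i j hij => ?_, fun j => ?_, fun i j hij => ?_⟩
    · simpa [hij.not_gt, hij.ne'] using h i j
    · simpa using h j j
    · simpa [hij] using h i j
  · rintro ⟨h1, h2, h3⟩ i j
    rcases lt_trichotomy i j with hij | rfl | hij
    · simpa [hij] using h3 i j hij
    · simpa using h2 i
    · simpa [hij.not_gt, hij.ne'] using h1 i j hij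

/-- Column `j` has `j` entries above the diagonal, each with `d j` possible values. -/
theorem card_hnfBlocks (d : Fin m → ℕ) : (hnfBlocks d).card = ∏ j, d j ^ (j : ℕ) := by
  rw [hnfBlocks, Finset.card_map]
  simp only [Fintype.card_piFinset]
  rw [Finset.prod_comm]
  refine Finset.prod_congr rfl fun j _ => ?_
  have h1 : ∀ i : Fin m, (if i < j then Finset.Ico (0 : ℤ) (d j) else
      if i = j then {(d j : ℤ)} else {0}).card = if i < j then d j else 1 := by
    intro i
    split_ifs <;> simp
  simp only [h1]
  rw [Finset.prod_ite, Finset.prod_const_one, mul_one, Finset.prod_const]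
  congr 1
  rw [← Fin.card_Iio j]
  congr 1
  ext i
  simp

theorem det_of_mem_hnfBlocks {d : Fin m → ℕ} {H : Matrix (Fin m) (Fin m) ℤ} (hH : H ∈ hnfBlocks d) :
    H.det = ∏ i, (d i : ℤ) := by
  rw [mem_hnfBlocks] at hH
  rw [Matrix.det_of_isUpperTriangular (fun i j hij => hH.1 i j hij)]
  exact Finset.prod_congr rfl fun i _ => hH.2.1 i

theorem hnfBlock_unique {d : Fin m → ℕ} (hd : ∀ i, 0 < d i) {H H' : Matrix (Fin m) (Fin m) ℤ} (hH : H ∈ hnfBlocks d)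
    (hH' : H' ∈ hnfBlocks d) {V V' : Matrix (Fin (m + 1)) (Fin (m + 1)) ℤ} (hV' : IsPrim V')
    (h : V * bord H 0 1 = V' * bord H' 0 1) : H = H' := by
  rw [mem_hnfBlocks] at hH hH'
  obtain ⟨U, hU⟩ := hV'
  let W : Matrix (Fin (m + 1)) (Fin (m + 1)) ℤ :=
    ((U⁻¹ : Matrix.GeneralLinearGroup (Fin (m + 1)) ℤ) : Matrix _ _ ℤ) * V
  have hW : ∀ i (j : Fin m), (W * bord H 0 1) i j.castSucc = bord H' 0 1 i j.castSucc := by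
    intro i j
    have h1 : ∀ i, (V' * bord H' 0 1) i j.castSucc =
        ((U : Matrix (Fin (m + 1)) (Fin (m + 1)) ℤ) * bord H' 0 1) i j.castSucc := by
      intro i
      simp only [mul_bord_castSucc, hU]
    rw [Matrix.mul_assoc, h, Matrix.mul_apply]
    simp only [h1]
    rw [← Matrix.mul_apply, ← Matrix.mul_assoc, ← Units.val_mul, inv_mul_cancel, Units.val_one,
      Matrix.one_mul]
  have hlt : ∀ i (j : Fin m),
      |bord H' 0 1 i j.castSucc - bord H 0 1 i j.castSucc| < (d j : ℤ) := by
    intro i j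
    have hdj : (0 : ℤ) < d j := by exact_mod_cast hd j
    refine Fin.lastCases ?_ (fun i => ?_) i
    · simpa using hdj
    · simp only [bord_castSucc_castSucc]
      rcases lt_trichotomy i j with hij | rfl | hij
      · have h1 := hH.2.2 i j hij
        have h2 := hH'.2.2 i j hij
        rw [abs_lt]
        constructor <;> linarith
      · rwa [hH.2.1, hH'.2.1, sub_self, abs_zero]
      · rwa [hH.1 i j hij, hH'.1 i j hij, sub_self, abs_zero]
  -- Induction on columns: once the earlier columns of `W - 1` vanish, `H' - H` in column `j` is `d
  -- j` times that column of `W - 1`. Its entries are smaller than `d j` in absolute value, so both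
  -- are zero.
  have key : ∀ n : ℕ, ∀ j : Fin m, (j : ℕ) = n → ∀ i,
      bord H' 0 1 i j.castSucc = bord H 0 1 i j.castSucc ∧
      (W - 1) i j.castSucc = 0 := by
    intro n
    induction n using Nat.strong_induction_on with
    | _ n ih =>
      intro j hj i
      have h1 : (W - 1) i j.castSucc * d j =
          bord H' 0 1 i j.castSucc - bord H 0 1 i j.castSucc := by
        have h2 : ((W - 1) * bord H 0 1) i j.castSucc =
            bord H' 0 1 i j.castSucc - bord H 0 1 i j.castSucc := by
          rw [Matrix.sub_mul, Matrix.one_mul, Matrix.sub_apply, hW]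
        rw [← h2, mul_bord_castSucc, Finset.sum_eq_single j]
        · rw [hH.2.1]
        · intro k _ hkj
          rcases lt_or_gt_of_ne hkj with hk | hk
          · rw [(ih k (hj ▸ hk) k rfl i).2, zero_mul]
          · rw [hH.1 k j hk, mul_zero]
        · simp
      have h3 : bord H' 0 1 i j.castSucc - bord H 0 1 i j.castSucc = 0 :=
        Int.eq_zero_of_abs_lt_dvd ⟨_, h1.symm.trans (mul_comm _ _)⟩ (hlt i j)
      rw [h3] at h1
      exact ⟨sub_eq_zero.1 h3, (mul_eq_zero.1 h1).resolve_right
        (by exact_mod_cast (hd j).ne')⟩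
  ext i j
  simpa using (key j j rfl i.castSucc).1.symm

end Blocks

/-! ### From the diagonal of the Hermite form to the leading block. -/

section HermiteForm

variable {m : ℕ}

/-- Nonzero diagonal entries make the first `m` rows nonzero and, with triangularity, place the
pivot of row `i` in column `i`. -/
theorem IsHNF.submatrix_mem_hnfBlocks {d : Fin m → ℕ} (hd : ∀ i, 0 < d i)
    {H : Matrix (Fin (m + 1)) (Fin (m + 1)) ℤ} (hH : IsHNF H)
    (hdiag : ∀ i : Fin m, H i.castSucc i.castSucc = d i) :
    H.submatrix Fin.castSucc Fin.castSucc ∈ hnfBlocks d := by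
  obtain ⟨hut, r, hr, j, hj, hzero, hpiv, hred⟩ := hH
  have hne : ∀ i : Fin m, H i.castSucc i.castSucc ≠ 0 := fun i => by
    rw [hdiag]
    exact_mod_cast (hd i).ne'
  have hir : ∀ i : Fin m, (i : ℕ) < r := by
    intro i
    by_contra h
    exact hne i (hzero i.castSucc (not_lt.1 h) _)
  have hji : ∀ i : Fin m, j ⟨i, hir i⟩ = i.castSucc := by
    intro i
    have h1 := hpiv ⟨i, hir i⟩
    have h2 : Fin.castLE hr ⟨i, hir i⟩ = i.castSucc := rfl
    rw [h2] at h1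
    apply le_antisymm
    · by_contra h
      exact hne i (h1.1 _ (not_le.1 h))
    · by_contra h
      exact h1.2.ne' (hut _ _ (not_le.1 h))
  rw [mem_hnfBlocks]
  refine ⟨fun a b hab => hut _ _ hab, hdiag, fun a b hab => ?_⟩
  have h1 := hred ⟨a, hir a⟩ ⟨b, hir b⟩ hab
  rw [hji] at h1
  have h2 : Fin.castLE hr ⟨b, hir b⟩ = b.castSucc := rfl
  rw [h2, hdiag] at h1
  exact h1

theorem isHNF_bord {d : Fin m → ℕ} (hd : ∀ i, 0 < d i) {H : Matrix (Fin m) (Fin m) ℤ}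
    (hH : H ∈ hnfBlocks d) {c : Fin m → ℤ} {t : ℤ} (ht : 0 ≤ t)
    (hc : t ≠ 0 → ∀ i, 0 ≤ c i ∧ c i < t) : IsHNF (bord H c t) := by
  rw [mem_hnfBlocks] at hH
  have hut : ∀ i l : Fin (m + 1), (l : ℕ) < (i : ℕ) → bord H c t i l = 0 := by
    intro i l
    refine Fin.lastCases ?_ (fun l => ?_) l
    · intro h
      exact absurd i.2 (by simpa using h)
    · refine Fin.lastCases ?_ (fun i => ?_) i
      · simp
      · intro h
        simpa using hH.1 i l h
  refine ⟨hut, ?_⟩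
  -- The rank is `m` if `t = 0` and `m + 1` otherwise; in the first case the last column has no
  -- pivot and needs no reduction.
  by_cases h0 : t = 0
  · refine ⟨m, Nat.le_succ m, Fin.castSucc, Fin.strictMono_castSucc, ?_, fun i => ⟨?_, ?_⟩, ?_⟩
    · intro i hi l
      have : i = Fin.last m := Fin.ext (le_antisymm (Nat.lt_succ_iff.1 i.2) hi)
      subst this
      refine Fin.lastCases ?_ (fun l => ?_) l
      · simpa using h0
      · simp
    · intro l hl
      exact hut _ _ hl
    · change 0 < bord H c t i.castSucc i.castSucc
      rw [bord_castSucc_castSucc, hH.2.1]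
      exact_mod_cast hd i
    · intro k i hki
      change 0 ≤ bord H c t k.castSucc i.castSucc ∧
        bord H c t k.castSucc i.castSucc < bord H c t i.castSucc i.castSucc
      rw [bord_castSucc_castSucc, bord_castSucc_castSucc, hH.2.1]
      exact hH.2.2 k i hki
  · refine ⟨m + 1, le_rfl, id, strictMono_id, ?_, fun i => ⟨?_, ?_⟩, ?_⟩
    · intro i hi
      exact absurd i.2 (not_lt.2 hi)
    · intro l hl
      exact hut _ _ hl
    · change 0 < bord H c t i i
      refine Fin.lastCases ?_ (fun i => ?_) i
      · rw [bord_last_last]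
        exact lt_of_le_of_ne ht (Ne.symm h0)
      · rw [bord_castSucc_castSucc, hH.2.1]
        exact_mod_cast hd i
    · intro k i
      change k < i → 0 ≤ bord H c t k i ∧ bord H c t k i < bord H c t i i
      refine Fin.lastCases ?_ (fun i => ?_) i <;> refine Fin.lastCases ?_ (fun k => ?_) k
      · intro h
        exact absurd h (lt_irrefl _)
      · intro _
        simpa using hc h0 k
      · intro h
        exact absurd h (Fin.castSucc_lt_last i).not_gt
      · intro h
        rw [bord_castSucc_castSucc, bord_castSucc_castSucc, hH.2.1]
        exact hH.2.2 k i h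

theorem exists_reduce_last (H : Matrix (Fin m) (Fin m) ℤ) (c : Fin m → ℤ) (t : ℤ) :
    ∃ (W : Matrix.GeneralLinearGroup (Fin (m + 1)) ℤ) (c' : Fin m → ℤ) (t' : ℤ),
      bord H c t = (W : Matrix (Fin (m + 1)) (Fin (m + 1)) ℤ) * bord H c' t' ∧ 0 ≤ t' ∧
      (t' ≠ 0 → ∀ i, 0 ≤ c' i ∧ c' i < t') := by
  by_cases h0 : t = 0
  · exact ⟨1, c, t, by simp, h0.ge, fun h => absurd h0 h⟩
  · have hdet : (bord (1 : Matrix (Fin m) (Fin m) ℤ) (fun i => c i / |t|) t.sign).det = t.sign := by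
      rw [det_bord, Matrix.det_one, one_mul]
    refine ⟨Matrix.GeneralLinearGroup.mk'' (bord 1 (fun i => c i / |t|) t.sign) ?_,
      fun i => c i % |t|, |t|, ?_, abs_nonneg t, fun _ i => ⟨?_, ?_⟩⟩
    · rw [hdet, Int.isUnit_iff_natAbs_eq]
      exact Int.natAbs_sign_of_ne_zero h0
    · change _ = bord 1 (fun i => c i / |t|) t.sign * _
      rw [bord_one_mul_bord, Int.sign_mul_abs]
      congr 1
      funext i
      exact (Int.emod_add_mul_ediv _ _).symm
    · exact Int.emod_nonneg _ (abs_ne_zero.2 h0)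
    · exact Int.emod_lt_of_pos _ (abs_pos.2 h0)

/-- The matrices whose Hermite normal form has a prescribed nonsingular leading block. -/
def blockSet (H : Matrix (Fin m) (Fin m) ℤ) : Set (Matrix (Fin (m + 1)) (Fin (m + 1)) ℤ) :=
  {A | ∃ V, IsPrim V ∧ A = V * bord H 0 1}

theorem exists_isHNFOf_iff {d : Fin m → ℕ} (hd : ∀ i, 0 < d i)
    (A : Matrix (Fin (m + 1)) (Fin (m + 1)) ℤ) :
    (∃ H : Matrix (Fin (m + 1)) (Fin (m + 1)) ℤ, IsHNFOf A H ∧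
      (∀ i : Fin m, H i.castSucc i.castSucc = d i) ∧
      (H (Fin.last m) (Fin.last m) : ℚ) = ((|A.det| : ℤ) : ℚ) / ∏ i, (d i : ℚ)) ↔
    ∃ H ∈ hnfBlocks d, A ∈ blockSet H := by
  constructor
  · rintro ⟨H, ⟨hH, U, hU⟩, hdiag, -⟩
    -- Primitivity ignores the last column of `V`, and `bord H 0 1` leaves it unchanged, so it can
    -- be taken from `A`.
    let V : Matrix (Fin (m + 1)) (Fin (m + 1)) ℤ := Matrix.of fun i =>
      Fin.snoc (α := fun _ => ℤ)
        (fun j : Fin m => (U : Matrix (Fin (m + 1)) (Fin (m + 1)) ℤ) i j.castSucc) (A i (Fin.last m))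
    refine ⟨_, hH.submatrix_mem_hnfBlocks hd hdiag, V, ⟨U, fun i j => by simp [V]⟩, ?_⟩
    ext i j
    refine Fin.lastCases ?_ (fun j => ?_) j
    · simp [mul_bord_last, V]
    · rw [mul_bord_castSucc, hU, Matrix.mul_apply, Fin.sum_univ_castSucc,
        hH.1 _ _ (Fin.castSucc_lt_last j), mul_zero, add_zero]
      simp [V]
  · rintro ⟨H, hH, V, ⟨U, hU⟩, rfl⟩
    set A := V * bord H 0 1
    -- Undoing `U` leaves a bordered matrix with block `H` and arbitrary last column, which
    -- `exists_reduce_last` brings to Hermite form without touching `H`.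
    let G : Matrix (Fin (m + 1)) (Fin (m + 1)) ℤ :=
      ((U⁻¹ : Matrix.GeneralLinearGroup (Fin (m + 1)) ℤ) :
        Matrix (Fin (m + 1)) (Fin (m + 1)) ℤ) * A
    have hG : ∀ i (j : Fin m), G i j.castSucc = bord H 0 1 i j.castSucc := by
      intro i j
      have h1 : ∀ i, A i j.castSucc =
          ((U : Matrix (Fin (m + 1)) (Fin (m + 1)) ℤ) * bord H 0 1) i j.castSucc := by
        intro i
        simp only [A, mul_bord_castSucc, hU]
      change (((U⁻¹ : Matrix.GeneralLinearGroup (Fin (m + 1)) ℤ) :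
        Matrix (Fin (m + 1)) (Fin (m + 1)) ℤ) * A) i j.castSucc = _
      rw [Matrix.mul_apply]
      simp only [h1]
      rw [← Matrix.mul_apply, ← Matrix.mul_assoc, ← Units.val_mul, inv_mul_cancel, Units.val_one,
        Matrix.one_mul]
    have hGb : G = bord H (fun i => G i.castSucc (Fin.last m)) (G (Fin.last m) (Fin.last m)) :=
      bord_ext (fun i j => by simp [hG]) (fun _ => rfl) (fun j => by simp [hG]) rfl
    obtain ⟨W, c, t, hW, ht, hc⟩ := exists_reduce_last H (fun i => G i.castSucc (Fin.last m))
      (G (Fin.last m) (Fin.last m))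
    have hA : A = ((U * W : Matrix.GeneralLinearGroup (Fin (m + 1)) ℤ) :
        Matrix (Fin (m + 1)) (Fin (m + 1)) ℤ) * bord H c t := by
      rw [Units.val_mul, Matrix.mul_assoc, ← hW, ← hGb, ← Matrix.mul_assoc, ← Units.val_mul,
        mul_inv_cancel, Units.val_one, Matrix.one_mul]
    refine ⟨bord H c t, ⟨isHNF_bord hd hH ht hc, U * W, hA⟩, fun i => ?_, ?_⟩
    · rw [bord_castSucc_castSucc, (mem_hnfBlocks.1 hH).2.1]
    · have hunit : IsUnit ((U * W : Matrix.GeneralLinearGroup (Fin (m + 1)) ℤ) :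
          Matrix (Fin (m + 1)) (Fin (m + 1)) ℤ).det :=
        (Matrix.isUnit_iff_isUnit_det _).1 (U * W).isUnit
      have hpos : 0 < ∏ i, (d i : ℤ) := Finset.prod_pos fun i _ => by exact_mod_cast hd i
      have hdet : |A.det| = (∏ i, (d i : ℤ)) * t := by
        rw [hA, Matrix.det_mul, abs_mul, Int.isUnit_iff_abs_eq.1 hunit, one_mul, det_bord,
          det_of_mem_hnfBlocks hH, abs_of_nonneg (mul_nonneg hpos.le ht)]
      have hpos' : (∏ i, (d i : ℚ)) ≠ 0 :=
        (Finset.prod_pos fun i _ => by exact_mod_cast hd i).ne'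
      rw [bord_last_last, hdet, eq_div_iff hpos']
      push_cast
      ring

theorem pairwiseDisjoint_blockSet {d : Fin m → ℕ} (hd : ∀ i, 0 < d i) :
    (hnfBlocks d : Set (Matrix (Fin m) (Fin m) ℤ)).PairwiseDisjoint blockSet := by
  intro H hH H' hH' hne
  rw [Function.onFun, Set.disjoint_left]
  rintro _ ⟨V, hV, rfl⟩ ⟨V', hV', h⟩
  exact hne (hnfBlock_unique hd hH hH' hV' h)

end HermiteForm

/-! ### Density of each block set, and the sum over blocks. -/

section BlockDensity

open scoped Kronecker

variable {m : ℕ}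

/-- Multiplication on the right by a matrix, on families of entries. -/
noncomputable def mulRightHom {n : ℕ} (K : Matrix (Fin n) (Fin n) ℤ) :
    (Fin n × Fin n → ℤ) →ₗ[ℤ] (Fin n × Fin n → ℤ) :=
  Matrix.toLin' ((1 : Matrix (Fin n) (Fin n) ℤ) ⊗ₖ K.transpose)

theorem toMat_mulRightHom {n : ℕ} (K : Matrix (Fin n) (Fin n) ℤ) (x : Fin n × Fin n → ℤ) :
    toMat (mulRightHom K x) = toMat x * K := by
  ext i j
  simp [toMat, mulRightHom, Matrix.mul_apply, Matrix.mulVec, dotProduct, Fintype.sum_prod_type,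
    Matrix.one_apply, mul_comm]

theorem det_mulRightHom {n : ℕ} (K : Matrix (Fin n) (Fin n) ℤ) :
    LinearMap.det (mulRightHom K) = K.det ^ n := by
  rw [mulRightHom, LinearMap.det_toLin', Matrix.det_kronecker]
  simp

theorem toMat_injective {n : ℕ} : Function.Injective (toMat (n := n)) := by
  intro x y h
  funext q
  exact congrFun (congrFun h q.1) q.2

theorem index_range_eq_natAbs_det {ι : Type*} [Fintype ι] (φ : (ι → ℤ) →ₗ[ℤ] (ι → ℤ))
    (hφ : Function.Injective φ) :
    (φ.toAddMonoidHom.range).index = (LinearMap.det φ).natAbs := by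
  have h := Submodule.natAbs_det_equiv (LinearMap.range φ) (LinearEquiv.ofInjective φ hφ)
  have h2 : (LinearMap.range φ).subtype ∘ₗ AddMonoidHom.toIntLinearMap
      ((LinearEquiv.ofInjective φ hφ : (ι → ℤ) ≃ₗ[ℤ] LinearMap.range φ) :
        (ι → ℤ) →+ LinearMap.range φ) = φ := by
    ext x
    rfl
  rw [h2] at h
  rw [h, AddSubgroup.index_eq_card]
  rfl

/-- The image of the primitive matrices is approximated from outside by imposing only the conditions
at primes `p ≤ M`; letting `M` tend to infinity gives the Euler product. -/
theorem hasNaturalDensity_blockSet {H : Matrix (Fin m) (Fin m) ℤ} (hH : H.det ≠ 0) :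
    HasNaturalDensity {x : Fin (m + 1) × Fin (m + 1) → ℤ | toMat x ∈ blockSet H}
      ((∏ k ∈ Finset.Icc 2 (m + 1), realZeta k)⁻¹ / |(H.det : ℝ)| ^ (m + 1)) := by
  have hK : (bord H 0 1).det = H.det := by rw [det_bord, mul_one]
  set φ := mulRightHom (bord H 0 1)
  have hφ : Function.Injective φ := by
    refine (injective_iff_map_eq_zero φ).2 fun x hx => ?_
    refine Matrix.eq_zero_of_mulVec_eq_zero ?_ hx
    rw [← LinearMap.det_toLin']
    change LinearMap.det φ ≠ 0
    rw [det_mulRightHom, hK]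
    exact pow_ne_zero _ hH
  have hidx := index_range_eq_natAbs_det φ hφ
  rw [det_mulRightHom, hK, Int.natAbs_pow] at hidx
  have hidx0 : (φ.toAddMonoidHom.range).index ≠ 0 := by
    rw [hidx]
    exact pow_ne_zero _ (Int.natAbs_ne_zero.2 hH)
  have hidxR : ((φ.toAddMonoidHom.range).index : ℝ) = |(H.det : ℝ)| ^ (m + 1) := by
    rw [hidx, Nat.cast_pow, Nat.cast_natAbs, Int.cast_abs]
  let T (M : ℕ) : Set ((p : (M + 1).primesBelow) → Fin (m + 1) × Fin (m + 1) → ZMod p) :=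
    {g | ∀ p : (M + 1).primesBelow, g p ∈ leadRegular m (ZMod p)}
  have hprime : ∀ M, ∀ p ∈ (M + 1).primesBelow, p.Prime := fun M p hp =>
    Nat.prime_of_mem_primesBelow hp
  have hmem : ∀ M v, v ∈ (reduceMod (Fin (m + 1) × Fin (m + 1)) (M + 1).primesBelow) ⁻¹' T M ↔
      ∀ p : ℕ, p.Prime → p ≤ M → ∃ i, ¬ (p : ℤ) ∣ leadMinor (toMat v) i := by
    intro M v
    constructor
    · intro h p hp hpM
      exact (intCast_mem_leadRegular v).1
        (h ⟨p, Nat.mem_primesBelow.2 ⟨Nat.lt_succ_of_le hpM, hp⟩⟩)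
    · intro h p
      exact (intCast_mem_leadRegular v).2
        (h p (hprime M p p.2) (Nat.lt_succ_iff.1 (Nat.mem_primesBelow.1 p.2).1))
  obtain ⟨C, hC⟩ := exists_density_degenerateAbove_le m
  refine hasNaturalDensity_of_approx
    (U := fun M => φ.toAddMonoidHom '' ((reduceMod _ (M + 1).primesBelow) ⁻¹' T M))
    (T := degenerateAbove m) (C := C) ?_ ?_ (fun M => ?_)
    ((tendsto_prod_local m).div_const (|(H.det : ℝ)| ^ (m + 1))) hC
  · rintro M x ⟨V, hV, hx⟩
    refine ⟨fun q => V q.1 q.2, (hmem M _).2 fun p hp _ => isPrim_iff.1 hV p hp, ?_⟩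
    apply toMat_injective
    rw [hx]
    exact toMat_mulRightHom _ _
  · rintro M _ ⟨v, hv, rfl⟩
    have hx : toMat (φ.toAddMonoidHom v) = toMat v * bord H 0 1 := toMat_mulRightHom _ _
    by_cases hprim : IsPrim (toMat v)
    · exact Or.inl ⟨toMat v, hprim, hx⟩
    · right
      rw [isPrim_iff] at hprim
      push Not at hprim
      obtain ⟨p, hp, hdvd⟩ := hprim
      refine ⟨p, hp, ?_, fun i => ?_⟩
      · by_contra hpM
        obtain ⟨i, hi⟩ := (hmem M v).1 hv p hp (not_lt.1 hpM)
        exact hi (hdvd i)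
      -- The exceptional set concerns the product rather than `v`, but its minors are those of `v`
      -- times `H.det`, so divisibility carries over.
      · rw [hx, leadMinor_mul_bord]
        exact Dvd.dvd.mul_right (hdvd i) _
  · have hF : ∀ p : (M + 1).primesBelow, NeZero (p : ℕ) := fun p => ⟨(hprime M p p.2).ne_zero⟩
    have h := hasNaturalDensity_image_preimage
      (reduceMod (Fin (m + 1) × Fin (m + 1)) (M + 1).primesBelow)
      (reduceMod_surjective _ _ (hprime M)) φ.toAddMonoidHom hφ hidx0 (T M)
    rw [hidxR, card_leadRegular_pi m _ (hprime M)] at h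
    exact h

/-- The `∏ d i ^ i` blocks have equal densities, each with `(∏ d i) ^ (m + 1)` in the denominator;
this leaves the exponents `m + 1 - i`. -/
theorem hasMatrixDensity_hnf {d : Fin m → ℕ} (hd : ∀ i, 0 < d i) :
    HasMatrixDensity {A : Matrix (Fin (m + 1)) (Fin (m + 1)) ℤ | ∃ H ∈ hnfBlocks d, A ∈ blockSet H}
      ((∏ k ∈ Finset.Icc 2 (m + 1), realZeta k) * ∏ i, (d i : ℝ) ^ (m + 1 - (i : ℕ)))⁻¹ := by
  have h := HasNaturalDensity.biUnion (hnfBlocks d)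
    (S := fun H => {x : Fin (m + 1) × Fin (m + 1) → ℤ | toMat x ∈ blockSet H})
    (δ := fun _ => (∏ k ∈ Finset.Icc 2 (m + 1), realZeta k)⁻¹ / (∏ i, (d i : ℝ)) ^ (m + 1))
    (fun H hH => by
      have hdet := det_of_mem_hnfBlocks hH
      have hpos : 0 < ∏ i, (d i : ℤ) := Finset.prod_pos fun i _ => by exact_mod_cast hd i
      have h1 := hasNaturalDensity_blockSet (H := H) (by rw [hdet]; exact hpos.ne')
      have h2 : |(H.det : ℝ)| = ∏ i, (d i : ℝ) := by
        rw [← Int.cast_abs, hdet, abs_of_pos hpos]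
        push_cast
        rfl
      rwa [h2] at h1)
    (fun H hH H' hH' hne => by
      rw [Function.onFun, Set.disjoint_left]
      intro x hx hx'
      exact Set.disjoint_left.1 (pairwiseDisjoint_blockSet hd hH hH' hne) hx hx')
  unfold HasMatrixDensity
  convert h using 1
  · ext x
    simp only [Set.mem_ofPred_eq, Set.mem_iUnion, exists_prop]
    rfl
  · rw [Finset.sum_const, nsmul_eq_mul, card_hnfBlocks, mul_inv, mul_div_assoc', mul_comm,
      mul_comm (Nat.cast _), mul_div_assoc, mul_comm]
    congr 1
    rw [Nat.cast_prod, ← Finset.prod_pow, ← Finset.prod_div_distrib, ← Finset.prod_inv_distrib]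
    refine Finset.prod_congr rfl fun i _ => ?_
    have hdi : (d i : ℝ) ≠ 0 := by exact_mod_cast (hd i).ne'
    have hi : (i : ℕ) ≤ m + 1 := by omega
    rw [pow_sub₀ _ hdi hi, mul_inv, inv_inv, Nat.cast_pow, div_eq_mul_inv, mul_comm]

end BlockDensity

end HermiteDensity

theorem mainTheorem2 (n : ℕ) (hn : 2 ≤ n) (d : Fin (n - 1) → ℕ) (hd : ∀ i, 0 < d i) :
    HermiteDensity.HasMatrixDensity
      {A : Matrix (Fin n) (Fin n) ℤ | ∃ H : Matrix (Fin n) (Fin n) ℤ,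
        HermiteDensity.IsHNFOf A H ∧
        (∀ i : Fin (n - 1), H ⟨i, by omega⟩ ⟨i, by omega⟩ = (d i : ℤ)) ∧
        (H ⟨n - 1, by omega⟩ ⟨n - 1, by omega⟩ : ℚ) = ((|A.det| : ℤ) : ℚ) / ∏ i, (d i : ℚ)}
      ((∏ k ∈ Finset.Icc 2 n, HermiteDensity.realZeta k) *
        ∏ i : Fin (n - 1), (d i : ℝ) ^ (n - (i : ℕ)))⁻¹ := by
  obtain ⟨m, rfl⟩ : ∃ m, n = m + 1 := ⟨n - 1, by omega⟩
  have h := HermiteDensity.hasMatrixDensity_hnf (m := m) (d := d) hd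
  -- With `n = m + 1`, the index `n - 1` reduces to `m` and the explicit `Fin` terms to `castSucc`
  -- and `last`, so the two descriptions agree definitionally.
  exact cast (congrArg (HermiteDensity.HasMatrixDensity · _)
    (Set.ext fun A => (HermiteDensity.exists_isHNFOf_iff (d := d) hd A).symm)) h
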